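/- Let $M$ be a smooth (Hausdorff) manifold of dimension $2n+1$ with an almost contact metric structure $(\varphi,\xi,\eta,g)$: a smooth $(1,1)$-tensor field $\varphi$, a smooth vector field $\xi$, a smooth $1$-form $\eta$ and a Riemannian metric $g$ with $\varphi^2=-I+\eta\otimes\xi$, $\eta(\xi)=1$ and $g(\varphi X,\varphi Y)=g(X,Y)-\eta(X)\eta(Y)$. Let $\Phi(X,Y)=g(X,\varphi Y)$, let $\nabla^g$ be the Levi-Civita connection of $g$ and $R^g(X,Y)Z=\nabla^g_X\nabla^g_YZ-\nabla^g_Y\nabla^g_XZ-\nabla^g_{[X,Y]}Z$ its curvature, and put $S=\varphi\circ\nabla^g\xi$, $h=\frac12\mathcal L_\xi\varphi$ and $\tilde X=(S^2-hS)X$. Assume that $M$ is $\mathcal H$-parallel, i.e. $(\nabla^g_X\Phi)(Y,Z)=0$ for all $X,Y,Z\in\mathcal H=\ker\eta$, and that $M$ admits a characteristic connection $\nabla$, i.e. a smooth affine connection with $\nabla g=0$, $\nabla\varphi=0$, $\nabla\xi=0$, $\nabla\eta=0$ whose torsion $T(X,Y,Z)=g(T(X,Y),Z)$ is totally skew-symmetric.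 Then the following are equivalent: (i) $\nabla T=0$; (ii) $R^g(\xi,X)Y=-\eta(Y)\tilde X+g(\tilde X,Y)\xi$ for all $X,Y\in TM$; (iii) $R^g(X,Y)\xi=\eta(Y)\tilde X-\eta(X)\tilde Y$ for all $X,Y\in TM$. Moreover, $S^2-hS=S^2$ if $M$ is of class $\mathcal C_6\oplus\mathcal C_7$, and $S^2-hS=-S^2$ if $M$ is of class $\mathcal C_{\min}$. Here $M$ is of class $U$ if $\nabla^g\Phi$, i.e. $(X,Y,Z)\mapsto(\nabla^g_X\Phi)(Y,Z)$, lies at each point $p$ in the corresponding subspace $U$ of $\mathcal C(T_pM)$. For a vector space $V$ of dimension $2n+1$ with an almost contact metric structure, $\mathcal C(V)$ consists of the trilinear forms $\alpha$ on $V$ with $$\alpha(X,Y,Z)=-\alpha(X,Z,Y)=-\alpha(X,\varphi Y,\varphi Z)+\eta(Y)\alpha(X,\xi,Z)+\eta(Z)\alpha(X,Y,\xi).$$ With $\delta_\alpha(Z)=-\sum_i\alpha(e_i,e_i,Z)$ for an orthonormal basis $(e_i)$ (so $\delta_\alpha=\delta\Phi$ for $\alpha=\nabla^g\Phi$) and $\beta_\alpha(X,Y)=\alpha(X,\xi,\varphi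 Y)$ (so $\beta_\alpha(X,Y)=(\nabla^g_X\eta)Y$ for $\alpha=\nabla^g\Phi$), the subspaces of $\mathcal C(V)$ in question are - $\mathcal C_6$: $\alpha(X,Y,Z)=\frac1{2n}\big[\eta(Y)g(X,Z)-\eta(Z)g(X,Y)\big]\delta_\alpha(\xi)$; - $\mathcal C_7$: $\alpha(X,Y,Z)=\eta(Z)\beta_\alpha(Y,\varphi X)+\eta(Y)\beta_\alpha(\varphi X,Z)$ and $\delta_\alpha=0$; - $\mathcal D_2$: $\alpha(X,Y,Z)=\eta(X)\alpha(\xi,Y,Z)+\eta(Y)\alpha(X,\xi,Z)+\eta(Z)\alpha(X,Y,\xi)$; - $\mathcal D_3$: $\alpha(X,Y,Z)=\eta(X)\eta(Y)\alpha(\xi,\xi,Z)+\eta(X)\eta(Z)\alpha(\xi,Y,\xi)$; - $\mathcal C_{\min}$: the $\alpha\in\mathcal D_2\oplus\mathcal D_3$ with $h_\alpha=2S_\alpha$, where the endomorphisms $S_\alpha$, $P_\alpha$, $h_\alpha$ are defined by $g(S_\alpha X,Z)=\alpha(X,\xi,Z)$, $g(P_\alpha Y,Z)=\alpha(\xi,Y,Z)$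 and $P_\alpha=-2h_\alpha+\varphi S_\alpha\varphi+S_\alpha$ (so $S_\alpha=S$, $h_\alpha=h$ for $\alpha=\nabla^g\Phi$). -/

import Mathlib

open Bundle VectorField
open scoped Manifold ContDiff

noncomputable section

/-! ### Riemannian metrics and the Levi-Civita connection -/

section LeviCivita

variable {E : Type*} [NormedAddCommGroup E] [NormedSpace ℝ E]
  {M : Type*} [TopologicalSpace M] [ChartedSpace E M] [IsManifold 𝓘(ℝ, E) ∞ M]

variable (E M) in
/-- Smooth Riemannian metrics on the manifold `M` (without boundary, modelled on `E`). -/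
abbrev SmoothMetric :=
  ContMDiffRiemannianMetric 𝓘(ℝ, E) ∞ E (fun x : M ↦ TangentSpace 𝓘(ℝ, E) x)

variable (g : SmoothMetric E M)

/-- The function `g(Y, Z)` is differentiable where the vector fields `Y` and `Z` are. -/
theorem SmoothMetric.mdifferentiableAt {x : M} {Y Z : Π x : M, TangentSpace 𝓘(ℝ, E) x}
    (hY : MDiffAt (T% Y) x) (hZ : MDiffAt (T% Z) x) :
    MDiffAt (fun y ↦ g.inner y (Y y) (Z y)) x := by
  have h1 := g.contMDiff.mdifferentiableAt (x := x) (by simp)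
  have h2 := MDifferentiableAt.clm_bundle_apply₂ (F₁ := E) (F₂ := E) h1 hY hZ
  simp only [mdifferentiableAt_totalSpace] at h2
  exact h2.2

/-- The Koszul expression, i.e. the right-hand side of the Koszul formula
`2 g(∇_X Y, Z) = X g(Y, Z) + Y g(X, Z) - Z g(X, Y) + g([X, Y], Z) - g([X, Z], Y) - g([Y, Z], X)`,
divided by two. -/
def koszul (Y X Z : Π x : M, TangentSpace 𝓘(ℝ, E) x) (x : M) : ℝ :=
  (1 / 2 : ℝ) *
    (d% (fun y ↦ g.inner y (Y y) (Z y)) x (X x) + d% (fun y ↦ g.inner y (X y) (Z y)) x (Y x)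
      - d% (fun y ↦ g.inner y (X y) (Y y)) x (Z x)
      + g.inner x (mlieBracket 𝓘(ℝ, E) X Y x) (Z x) - g.inner x (mlieBracket 𝓘(ℝ, E) X Z x) (Y x)
      - g.inner x (mlieBracket 𝓘(ℝ, E) Y Z x) (X x))

variable [FiniteDimensional ℝ E]

theorem koszul_tensorial_left {x : M} {Y Z : Π x : M, TangentSpace 𝓘(ℝ, E) x}
    (hY : MDiffAt (T% Y) x) (hZ : MDiffAt (T% Z) x) :
    TensorialAt 𝓘(ℝ, E) E (fun X ↦ koszul g Y X Z x) x where
  smul {f X} hf hX := by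
    simp [koszul, mvfderiv_fun_mul hf (g.mdifferentiableAt hX hZ),
      mvfderiv_fun_mul hf (g.mdifferentiableAt hX hY), mlieBracket_smul_left hf hX]
    ring
  add {X X'} hX hX' := by
    simp [koszul, mvfderiv_fun_add (g.mdifferentiableAt hX hZ) (g.mdifferentiableAt hX' hZ),
      mvfderiv_fun_add (g.mdifferentiableAt hX hY) (g.mdifferentiableAt hX' hY),
      mlieBracket_add_left hX hX']
    ring

theorem koszul_tensorial_right {x : M} {Y X : Π x : M, TangentSpace 𝓘(ℝ, E) x}
    (hY : MDiffAt (T% Y) x) (hX : MDiffAt (T% X) x) :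
    TensorialAt 𝓘(ℝ, E) E (fun Z ↦ koszul g Y X Z x) x where
  smul {f Z} hf hZ := by
    simp [koszul, mvfderiv_fun_mul hf (g.mdifferentiableAt hX hZ),
      mvfderiv_fun_mul hf (g.mdifferentiableAt hY hZ), mlieBracket_smul_right hf hZ]
    rw [g.symm x (X x) (Z x), g.symm x (Z x) (Y x)]
    ring
  add {Z Z'} hZ hZ' := by
    simp [koszul, mvfderiv_fun_add (g.mdifferentiableAt hX hZ) (g.mdifferentiableAt hX hZ'),
      mvfderiv_fun_add (g.mdifferentiableAt hY hZ) (g.mdifferentiableAt hY hZ'),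
      mlieBracket_add_right hZ hZ']
    ring

instance (x : M) : FiniteDimensional ℝ (TangentSpace 𝓘(ℝ, E) x) :=
  inferInstanceAs (FiniteDimensional ℝ E)

instance (x : M) : T2Space (TangentSpace 𝓘(ℝ, E) x) :=
  inferInstanceAs (T2Space E)

/-- The musical isomorphism `v ↦ g(v, ·)` at the point `x`. -/
def SmoothMetric.flat (x : M) :
    TangentSpace 𝓘(ℝ, E) x ≃L[ℝ] (TangentSpace 𝓘(ℝ, E) x →L[ℝ] ℝ) :=
  (LinearMap.linearEquivOfInjective
    (g.inner x : TangentSpace 𝓘(ℝ, E) x →ₗ[ℝ] (TangentSpace 𝓘(ℝ, E) x →L[ℝ] ℝ))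
    (by
      rw [injective_iff_map_eq_zero]
      intro v hv
      by_contra hne
      have h1 := g.pos x v hne
      have h2 : g.inner x v = 0 := hv
      simp [h2] at h1)
    (by
      rw [← (LinearMap.toContinuousLinearMap
        (𝕜 := ℝ) (E := TangentSpace 𝓘(ℝ, E) x) (F' := ℝ)).finrank_eq]
      exact Subspace.dual_finrank_eq.symm)).toContinuousLinearEquiv

theorem SmoothMetric.flat_apply (x : M) (v : TangentSpace 𝓘(ℝ, E) x) :
    g.flat x v = g.inner x v := rfl

theorem SmoothMetric.inner_flat_symm (x : M) (l : TangentSpace 𝓘(ℝ, E) x →L[ℝ] ℝ)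
    (w : TangentSpace 𝓘(ℝ, E) x) : g.inner x ((g.flat x).symm l) w = l w := by
  rw [← g.flat_apply, ContinuousLinearEquiv.apply_symm_apply]

theorem SmoothMetric.ext_inner {x : M} {v w : TangentSpace 𝓘(ℝ, E) x}
    (h : ∀ Z : Π x : M, TangentSpace 𝓘(ℝ, E) x, MDiffAt (T% Z) x →
      g.inner x v (Z x) = g.inner x w (Z x)) : v = w := by
  apply (g.flat x).injective
  ext z
  have := h (FiberBundle.extend E z) (FiberBundle.mdifferentiableAt_extend ..)
  simpa [g.flat_apply] using this

open Classical in
/-- The underlying map of the Levi-Civita connection: for `Y` differentiable at `x`, `∇_u Y` is the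
vector with `g(∇_u Y, w) = koszul Y u w` for all `w`. As for every `CovariantDerivative`, the value
on fields that are not differentiable at `x` is irrelevant. -/
def leviCivitaAux (Y : Π x : M, TangentSpace 𝓘(ℝ, E) x) (x : M) :
    TangentSpace 𝓘(ℝ, E) x →L[ℝ] TangentSpace 𝓘(ℝ, E) x :=
  if hY : MDiffAt (T% Y) x then
    ((g.flat x).symm : (TangentSpace 𝓘(ℝ, E) x →L[ℝ] ℝ) →L[ℝ] TangentSpace 𝓘(ℝ, E) x) ∘L
      TensorialAt.mkHom₂ (I := 𝓘(ℝ, E)) (F := E) (F' := E) (fun X Z ↦ koszul g Y X Z x) x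
        (fun _ hZ ↦ koszul_tensorial_left g hY hZ) (fun _ hX ↦ koszul_tensorial_right g hY hX)
  else 0

theorem inner_leviCivitaAux {x : M} {X Y Z : Π x : M, TangentSpace 𝓘(ℝ, E) x}
    (hX : MDiffAt (T% X) x) (hY : MDiffAt (T% Y) x) (hZ : MDiffAt (T% Z) x) :
    g.inner x (leviCivitaAux g Y x (X x)) (Z x) = koszul g Y X Z x := by
  rw [leviCivitaAux, dif_pos hY]
  simp only [ContinuousLinearMap.comp_apply, ContinuousLinearEquiv.coe_coe]
  rw [g.inner_flat_symm]
  exact TensorialAt.mkHom₂_apply (I := 𝓘(ℝ, E)) (F := E) (F' := E)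
    (Φ := fun X Z ↦ koszul g Y X Z x) _ _ hX hZ

/-- The Levi-Civita connection `∇^g`, constructed from the Koszul formula. -/
def leviCivita : CovariantDerivative 𝓘(ℝ, E) E (fun x : M ↦ TangentSpace 𝓘(ℝ, E) x) where
  toFun := leviCivitaAux g
  isCovariantDerivativeOnUniv :=
    { add := by
        intro Y Y' x hY hY' _
        ext u
        apply g.ext_inner
        intro Z hZ
        have hu := FiberBundle.mdifferentiableAt_extend 𝓘(ℝ, E) E u
        have e : FiberBundle.extend E u x = u := by simp
        have hadd : MDiffAt (T% (Y + Y')) x := mdifferentiableAt_add_section hY hY'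
        have h1 := inner_leviCivitaAux g hu hadd hZ
        have h2 := inner_leviCivitaAux g hu hY hZ
        have h3 := inner_leviCivitaAux g hu hY' hZ
        rw [e] at h1 h2 h3
        simp only [add_apply, map_add]
        rw [h1, h2, h3]
        simp [koszul, mvfderiv_fun_add (g.mdifferentiableAt hY hZ) (g.mdifferentiableAt hY' hZ),
          mvfderiv_fun_add (g.mdifferentiableAt hu hY) (g.mdifferentiableAt hu hY'),
          mlieBracket_add_left hY hY', mlieBracket_add_right hY hY']
        ring
      leibniz := by
        intro Y f x hY hf _
        ext u
        apply g.ext_inner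
        intro Z hZ
        have hu := FiberBundle.mdifferentiableAt_extend 𝓘(ℝ, E) E u
        have e : FiberBundle.extend E u x = u := by simp
        have hsmul : MDiffAt (T% (f • Y)) x := hf.smul_section hY
        have h1 := inner_leviCivitaAux g hu hsmul hZ
        have h2 := inner_leviCivitaAux g hu hY hZ
        rw [e] at h1 h2
        simp only [add_apply, map_add, smul_apply,
          ContinuousLinearMap.smulRight_apply, map_smul, smul_eq_mul]
        rw [h1, h2]
        simp [koszul, mvfderiv_fun_mul hf (g.mdifferentiableAt hY hZ),
          mvfderiv_fun_mul hf (g.mdifferentiableAt hu hY),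
          mlieBracket_smul_left hf hY, mlieBracket_smul_right hf hY]
        rw [g.symm x u (Y x)]
        ring }

theorem inner_leviCivita {x : M} {X Y Z : Π x : M, TangentSpace 𝓘(ℝ, E) x}
    (hX : MDiffAt (T% X) x) (hY : MDiffAt (T% Y) x) (hZ : MDiffAt (T% Z) x) :
    g.inner x (leviCivita g Y x (X x)) (Z x) = koszul g Y X Z x :=
  inner_leviCivitaAux g hX hY hZ

/-- The Levi-Civita connection is torsion-free. -/
theorem leviCivita_torsion : (leviCivita g).torsion = 0 := by
  rw [CovariantDerivative.torsion_eq_zero_iff]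
  intro X Y x hX hY
  apply g.ext_inner
  intro Z hZ
  rw [map_sub, sub_apply, inner_leviCivita g hX hY hZ,
    inner_leviCivita g hY hX hZ, koszul, koszul]
  have h1 : (fun y ↦ g.inner y (X y) (Y y)) = fun y ↦ g.inner y (Y y) (X y) := by
    ext y; exact g.symm y _ _
  rw [h1, mlieBracket_swap_apply (V := Y) (W := X)]
  simp
  ring

/-- The Levi-Civita connection is metric. -/
theorem leviCivita_metric {x : M} {X Y Z : Π x : M, TangentSpace 𝓘(ℝ, E) x}
    (hX : MDiffAt (T% X) x) (hY : MDiffAt (T% Y) x) (hZ : MDiffAt (T% Z) x) :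
    d% (fun y ↦ g.inner y (Y y) (Z y)) x (X x) =
      g.inner x (leviCivita g Y x (X x)) (Z x) + g.inner x (Y x) (leviCivita g Z x (X x)) := by
  rw [g.symm x (Y x), inner_leviCivita g hX hY hZ, inner_leviCivita g hX hZ hY, koszul, koszul]
  have h1 : (fun y ↦ g.inner y (Z y) (Y y)) = fun y ↦ g.inner y (Y y) (Z y) := by
    ext y; exact g.symm y _ _
  rw [h1, mlieBracket_swap_apply (V := Z) (W := Y)]
  simp
  ring

/-- The Riemannian curvature `R(X, Y)Z = ∇_X ∇_Y Z - ∇_Y ∇_X Z - ∇_{[X, Y]} Z` of `g`. -/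
def riemannCurvature (X Y Z : Π x : M, TangentSpace 𝓘(ℝ, E) x) (x : M) :
    TangentSpace 𝓘(ℝ, E) x :=
  leviCivita g (fun y ↦ leviCivita g Z y (Y y)) x (X x)
    - leviCivita g (fun y ↦ leviCivita g Z y (X y)) x (Y x)
    - leviCivita g Z x (mlieBracket 𝓘(ℝ, E) X Y x)

end LeviCivita

/-! ### Almost contact metric structures on a vector space and classes of tensors -/

/-- An almost contact metric structure `(φ, ξ, η, g)` on a real vector space `V`. -/
structure LinearACM (V : Type*) [AddCommGroup V] [Module ℝ V] where
  φ : V →ₗ[ℝ] V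
  ξ : V
  η : V →ₗ[ℝ] ℝ
  g : V →ₗ[ℝ] V →ₗ[ℝ] ℝ
  g_symm : ∀ v w, g v w = g w v
  g_pos : ∀ v, v ≠ 0 → 0 < g v v
  φ_sq : ∀ v, φ (φ v) = -v + η v • ξ
  η_ξ : η ξ = 1
  g_φ : ∀ v w, g (φ v) (φ w) = g v w - η v * η w

/-- Trilinear forms, i.e. tensors of type `(0,3)`. -/
abbrev Trilinear (V : Type*) [AddCommGroup V] [Module ℝ V] := V →ₗ[ℝ] V →ₗ[ℝ] V →ₗ[ℝ] ℝ

namespace LinearACM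

variable {V : Type*} [AddCommGroup V] [Module ℝ V] (A : LinearACM V)

/-- The space `𝒞(V)` of tensors with the algebraic symmetries of `∇^g Φ`. -/
def spaceC : Submodule ℝ (Trilinear V) where
  carrier := {α | ∀ X Y Z, α X Y Z = -α X Z Y ∧
    α X Y Z = -α X (A.φ Y) (A.φ Z) + A.η Y * α X A.ξ Z + A.η Z * α X Y A.ξ}
  add_mem' {α β} hα hβ X Y Z := by
    obtain ⟨h1, h2⟩ := hα X Y Z
    obtain ⟨h3, h4⟩ := hβ X Y Z
    simp only [LinearMap.add_apply]
    exact ⟨by linear_combination h1 + h3, by linear_combination h2 + h4⟩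
  zero_mem' X Y Z := by simp
  smul_mem' c α hα X Y Z := by
    obtain ⟨h1, h2⟩ := hα X Y Z
    simp only [LinearMap.smul_apply, smul_eq_mul]
    constructor
    · linear_combination c * h1
    · linear_combination c * h2

/-- `𝒟₂`. -/
def classD2 : Submodule ℝ (Trilinear V) where
  carrier := {α | α ∈ A.spaceC ∧ ∀ X Y Z,
    α X Y Z = A.η X * α A.ξ Y Z + A.η Y * α X A.ξ Z + A.η Z * α X Y A.ξ}
  add_mem' {α β} hα hβ := by
    refine ⟨add_mem hα.1 hβ.1, fun X Y Z ↦ ?_⟩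
    simp only [LinearMap.add_apply]
    linear_combination hα.2 X Y Z + hβ.2 X Y Z
  zero_mem' := ⟨zero_mem _, by simp⟩
  smul_mem' c α hα := by
    refine ⟨Submodule.smul_mem _ c hα.1, fun X Y Z ↦ ?_⟩
    simp only [LinearMap.smul_apply, smul_eq_mul]
    linear_combination c * hα.2 X Y Z

/-- `𝒟₃ = 𝒞₁₂`. -/
def classD3 : Submodule ℝ (Trilinear V) where
  carrier := {α | α ∈ A.spaceC ∧ ∀ X Y Z,
    α X Y Z = A.η X * A.η Y * α A.ξ A.ξ Z + A.η X * A.η Z * α A.ξ Y A.ξ}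
  add_mem' {α β} hα hβ := by
    refine ⟨add_mem hα.1 hβ.1, fun X Y Z ↦ ?_⟩
    simp only [LinearMap.add_apply]
    linear_combination hα.2 X Y Z + hβ.2 X Y Z
  zero_mem' := ⟨zero_mem _, by simp⟩
  smul_mem' c α hα := by
    refine ⟨Submodule.smul_mem _ c hα.1, fun X Y Z ↦ ?_⟩
    simp only [LinearMap.smul_apply, smul_eq_mul]
    linear_combination c * hα.2 X Y Z

/-- `e` is a `g`-orthonormal basis. -/
def IsOrthonormalBasis {ι : Type*} (e : Module.Basis ι ℝ V) : Prop :=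
  (∀ i, A.g (e i) (e i) = 1) ∧ ∀ i j, i ≠ j → A.g (e i) (e j) = 0

/-- The codifferential `δΦ(Z) = -∑ᵢ (∇_{eᵢ} Φ)(eᵢ, Z)`, expressed through `α = ∇Φ` and an
orthonormal basis `e`. -/
def codiff {ι : Type*} [Fintype ι] (e : Module.Basis ι ℝ V) (α : Trilinear V) (Z : V) : ℝ :=
  -∑ i, α (e i) (e i) Z

/-- `𝒞₆`, in dimension `2n+1`: the tensors with
`α(X,Y,Z) = 1/(2n) [η(Y) g(X,Z) - η(Z) g(X,Y)] δΦ(ξ)`. The codifferential does not depend on the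
orthonormal basis, so it is required for each of them. -/
def classC6 (n : ℕ) : Submodule ℝ (Trilinear V) where
  carrier := {α | α ∈ A.spaceC ∧ ∀ e : Module.Basis (Fin (2 * n + 1)) ℝ V,
    A.IsOrthonormalBasis e → ∀ X Y Z,
      α X Y Z = 1 / (2 * n) * (A.η Y * A.g X Z - A.η Z * A.g X Y) * codiff e α A.ξ}
  add_mem' {α β} hα hβ := by
    refine ⟨add_mem hα.1 hβ.1, fun e he X Y Z ↦ ?_⟩
    have h1 := hα.2 e he X Y Z
    have h2 := hβ.2 e he X Y Z
    simp only [codiff, LinearMap.add_apply, Finset.sum_add_distrib] at h1 h2 ⊢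
    linear_combination h1 + h2
  zero_mem' := ⟨zero_mem _, by simp [codiff]⟩
  smul_mem' c α hα := by
    refine ⟨Submodule.smul_mem _ c hα.1, fun e he X Y Z ↦ ?_⟩
    have h1 := hα.2 e he X Y Z
    simp only [codiff, LinearMap.smul_apply, smul_eq_mul, ← Finset.mul_sum] at h1 ⊢
    linear_combination c * h1

/-- `(∇_X η)(Y) = (∇_X Φ)(ξ, φY)`, expressed through `α = ∇Φ`. -/
def nablaEta (α : Trilinear V) (X Y : V) : ℝ := α X A.ξ (A.φ Y)

/-- `𝒞₇`, in dimension `2n+1`: the tensors with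
`α(X,Y,Z) = η(Z) (∇_Y η)(φX) + η(Y) (∇_{φX} η)(Z)` and `δΦ = 0`. -/
def classC7 (n : ℕ) : Submodule ℝ (Trilinear V) where
  carrier := {α | α ∈ A.spaceC ∧
    (∀ X Y Z, α X Y Z = A.η Z * A.nablaEta α Y (A.φ X) + A.η Y * A.nablaEta α (A.φ X) Z) ∧
    ∀ e : Module.Basis (Fin (2 * n + 1)) ℝ V, A.IsOrthonormalBasis e → ∀ Z, codiff e α Z = 0}
  add_mem' {α β} hα hβ := by
    refine ⟨add_mem hα.1 hβ.1, fun X Y Z ↦ ?_, fun e he Z ↦ ?_⟩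
    · have h1 := hα.2.1 X Y Z
      have h2 := hβ.2.1 X Y Z
      simp only [nablaEta, LinearMap.add_apply] at h1 h2 ⊢
      linear_combination h1 + h2
    · have h1 := hα.2.2 e he Z
      have h2 := hβ.2.2 e he Z
      simp only [codiff, LinearMap.add_apply, Finset.sum_add_distrib] at h1 h2 ⊢
      linear_combination h1 + h2
  zero_mem' := ⟨zero_mem _, by simp [nablaEta], by simp [codiff]⟩
  smul_mem' c α hα := by
    refine ⟨Submodule.smul_mem _ c hα.1, fun X Y Z ↦ ?_, fun e he Z ↦ ?_⟩
    · have h1 := hα.2.1 X Y Z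
      simp only [nablaEta, LinearMap.smul_apply, smul_eq_mul] at h1 ⊢
      linear_combination c * h1
    · have h1 := hα.2.2 e he Z
      simp only [codiff, LinearMap.smul_apply, smul_eq_mul, ← Finset.mul_sum] at h1 ⊢
      linear_combination c * h1

/-- The reducible class `𝒞₆ ⊕ 𝒞₇`. -/
def classC6C7 (n : ℕ) : Submodule ℝ (Trilinear V) := A.classC6 n ⊔ A.classC7 n

/-- The bilinear form `g(S_α X, Z) = α(X, ξ, Z)` of the endomorphism `S` associated with `α`. -/
def formS (α : Trilinear V) (X Z : V) : ℝ := α X A.ξ Z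

/-- The bilinear form `g(P_α Y, Z) = α(ξ, Y, Z)` of the endomorphism `P` associated with `α`. -/
def formP (α : Trilinear V) (Y Z : V) : ℝ := α A.ξ Y Z

/-- The bilinear form `g(h_α Y, Z)` of the endomorphism `h` associated with `α`, which is defined by
`P = -2h + φSφ + S`; note that `g(φSφY, Z) = -g(SφY, φZ)`. -/
def formH (α : Trilinear V) (Y Z : V) : ℝ :=
  (1 / 2) * (-A.formS α (A.φ Y) (A.φ Z) + A.formS α Y Z - A.formP α Y Z)

/-- The class `𝒞_min`: the tensors in `𝒟₂ ⊕ 𝒟₃` with `h = 2S`. -/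
def classCmin : Submodule ℝ (Trilinear V) where
  carrier := {α | α ∈ A.classD2 ⊔ A.classD3 ∧ ∀ Y Z, A.formH α Y Z = 2 * A.formS α Y Z}
  add_mem' {α β} hα hβ := by
    refine ⟨add_mem hα.1 hβ.1, fun Y Z ↦ ?_⟩
    have h1 := hα.2 Y Z
    have h2 := hβ.2 Y Z
    simp only [formH, formS, formP, LinearMap.add_apply] at h1 h2 ⊢
    linear_combination h1 + h2
  zero_mem' := ⟨zero_mem _, by simp [formH, formS, formP]⟩
  smul_mem' c α hα := by
    refine ⟨Submodule.smul_mem _ c hα.1, fun Y Z ↦ ?_⟩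
    have h1 := hα.2 Y Z
    simp only [formH, formS, formP, LinearMap.smul_apply, smul_eq_mul] at h1 ⊢
    linear_combination c * h1

end LinearACM

/-! ### Almost contact metric manifolds -/

/-- An almost contact metric structure `(φ, ξ, η, g)` on the smooth manifold `M`. -/
structure AlmostContactMetric (E : Type*) [NormedAddCommGroup E] [NormedSpace ℝ E]
    (M : Type*) [TopologicalSpace M] [ChartedSpace E M] [IsManifold 𝓘(ℝ, E) ∞ M] where
  /-- The Riemannian metric. -/
  g : SmoothMetric E M
  /-- The `(1,1)`-tensor field. -/
  φ : Π x : M, TangentSpace 𝓘(ℝ, E) x →L[ℝ] TangentSpace 𝓘(ℝ, E) x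
  /-- The Reeb vector field. -/
  ξ : Π x : M, TangentSpace 𝓘(ℝ, E) x
  /-- The `1`-form. -/
  η : Π x : M, TangentSpace 𝓘(ℝ, E) x →L[ℝ] ℝ
  φ_smooth : ContMDiff 𝓘(ℝ, E) (𝓘(ℝ, E).prod 𝓘(ℝ, E →L[ℝ] E)) ∞
    (fun x ↦ TotalSpace.mk' (E →L[ℝ] E) x (φ x))
  ξ_smooth : ContMDiff 𝓘(ℝ, E) (𝓘(ℝ, E).prod 𝓘(ℝ, E)) ∞ (fun x ↦ TotalSpace.mk' E x (ξ x))
  η_smooth : ContMDiff 𝓘(ℝ, E) (𝓘(ℝ, E).prod 𝓘(ℝ, E →L[ℝ] ℝ)) ∞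
    (fun x ↦ TotalSpace.mk' (E →L[ℝ] ℝ) x (η x))
  φ_sq : ∀ x v, φ x (φ x v) = -v + η x v • ξ x
  η_ξ : ∀ x, η x (ξ x) = 1
  g_φ : ∀ x v w, g.inner x (φ x v) (φ x w) = g.inner x v w - η x v * η x w

namespace AlmostContactMetric

variable {E : Type*} [NormedAddCommGroup E] [NormedSpace ℝ E]
  {M : Type*} [TopologicalSpace M] [ChartedSpace E M] [IsManifold 𝓘(ℝ, E) ∞ M]
  (s : AlmostContactMetric E M)

/-- The almost contact metric structure of the tangent space at `x`. -/
def atPoint (x : M) : LinearACM (TangentSpace 𝓘(ℝ, E) x) where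
  φ := s.φ x
  ξ := s.ξ x
  η := s.η x
  g := (ContinuousLinearMap.coeLM ℝ) ∘ₗ (s.g.inner x).toLinearMap
  g_symm := s.g.symm x
  g_pos := s.g.pos x
  φ_sq := s.φ_sq x
  η_ξ := s.η_ξ x
  g_φ := s.g_φ x

theorem φ_mdifferentiableAt {x : M} {Y : Π x : M, TangentSpace 𝓘(ℝ, E) x}
    (hY : MDiffAt (T% Y) x) : MDiffAt (T% (fun y ↦ s.φ y (Y y))) x :=
  MDifferentiableAt.clm_bundle_apply (F₁ := E) (F₂ := E)
    (s.φ_smooth.mdifferentiableAt (x := x) (by simp)) hY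

theorem η_mdifferentiableAt {x : M} {Y : Π x : M, TangentSpace 𝓘(ℝ, E) x}
    (hY : MDiffAt (T% Y) x) : MDiffAt (fun y ↦ s.η y (Y y)) x := by
  have h1 := s.η_smooth.mdifferentiableAt (x := x) (by simp)
  have h2 := MDifferentiableAt.clm_bundle_apply (F₁ := E) (F₂ := ℝ)
    (E₂ := Bundle.Trivial M ℝ) h1 hY
  simp only [mdifferentiableAt_totalSpace] at h2
  exact h2.2

variable [FiniteDimensional ℝ E]

/-- `(∇^g_{(·)} Φ)(Y, Z)` at the point `x`, for vector fields `Y`, `Z` and the fundamental 2-form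
`Φ(Y, Z) = g(Y, φZ)`: the form `u ↦ u(Φ(Y, Z)) - Φ(∇_u Y, Z) - Φ(Y, ∇_u Z)`,
where `Φ(∇_u Y, Z) = g(∇_u Y, φZ) = g(φZ, ∇_u Y)`. -/
def nablaPhiAux (Y Z : Π x : M, TangentSpace 𝓘(ℝ, E) x) (x : M) :
    TangentSpace 𝓘(ℝ, E) x →L[ℝ] ℝ :=
  d% (fun y ↦ s.g.inner y (Y y) (s.φ y (Z y))) x
    - s.g.inner x (s.φ x (Z x)) ∘L leviCivita s.g Y x
    - s.g.inner x (Y x) ∘L s.φ x ∘L leviCivita s.g Z x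

theorem nablaPhiAux_tensorial_left {x : M} {Z : Π x : M, TangentSpace 𝓘(ℝ, E) x}
    (hZ : MDiffAt (T% Z) x) : TensorialAt 𝓘(ℝ, E) E (fun Y ↦ s.nablaPhiAux Y Z x) x where
  smul {f Y} hf hY := by
    ext u
    simp [nablaPhiAux, mvfderiv_fun_mul hf (s.g.mdifferentiableAt hY (s.φ_mdifferentiableAt hZ)),
      (leviCivita s.g).isCovariantDerivativeOn.leibniz hY hf]
    rw [s.g.symm x (s.φ x (Z x)) (Y x)]
    ring
  add {Y Y'} hY hY' := by
    ext u
    simp [nablaPhiAux, mvfderiv_fun_add (s.g.mdifferentiableAt hY (s.φ_mdifferentiableAt hZ))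
      (s.g.mdifferentiableAt hY' (s.φ_mdifferentiableAt hZ)),
      (leviCivita s.g).isCovariantDerivativeOn.add hY hY']
    ring

theorem nablaPhiAux_tensorial_right {x : M} {Y : Π x : M, TangentSpace 𝓘(ℝ, E) x}
    (hY : MDiffAt (T% Y) x) : TensorialAt 𝓘(ℝ, E) E (fun Z ↦ s.nablaPhiAux Y Z x) x where
  smul {f Z} hf hZ := by
    ext u
    simp [nablaPhiAux, mvfderiv_fun_mul hf (s.g.mdifferentiableAt hY (s.φ_mdifferentiableAt hZ)),
      (leviCivita s.g).isCovariantDerivativeOn.leibniz hZ hf]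
    ring
  add {Z Z'} hZ hZ' := by
    ext u
    simp [nablaPhiAux, mvfderiv_fun_add (s.g.mdifferentiableAt hY (s.φ_mdifferentiableAt hZ))
      (s.g.mdifferentiableAt hY (s.φ_mdifferentiableAt hZ')),
      (leviCivita s.g).isCovariantDerivativeOn.add hZ hZ']
    ring

/-- The tensor `∇^g Φ`; mind the order of the arguments, `nablaPhi x v w u = (∇^g_u Φ)(v, w)`. -/
def nablaPhi (x : M) : TangentSpace 𝓘(ℝ, E) x →L[ℝ] TangentSpace 𝓘(ℝ, E) x →L[ℝ]
    (TangentSpace 𝓘(ℝ, E) x →L[ℝ] ℝ) :=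
  TensorialAt.mkHom₂ (I := 𝓘(ℝ, E)) (F := E) (F' := E) (fun Y Z ↦ s.nablaPhiAux Y Z x) x
    (fun _ hZ ↦ s.nablaPhiAux_tensorial_left hZ) (fun _ hY ↦ s.nablaPhiAux_tensorial_right hY)

/-- `M` is `ℋ`-parallel: `(∇^g_X Φ)(Y, Z) = 0` for all `X, Y, Z` in `ℋ = ker η`. -/
def IsHParallel : Prop :=
  ∀ (x : M) (u v w : TangentSpace 𝓘(ℝ, E) x), s.η x u = 0 → s.η x v = 0 → s.η x w = 0 →
    s.nablaPhi x v w u = 0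

/-- `M` is of class `U`: at every point the trilinear form `(X, Y, Z) ↦ (∇^g_X Φ)(Y, Z)` on the
tangent space lies in the space `U` of tensors. -/
def IsOfClass
    (U : ∀ {V : Type _} [AddCommGroup V] [Module ℝ V], LinearACM V → Submodule ℝ (Trilinear V)) :
    Prop :=
  ∀ x : M, ∃ α ∈ U (s.atPoint x), ∀ u v w, α u v w = s.nablaPhi x v w u

/-- The intrinsic endomorphism `S = φ ∘ ∇^g ξ`. -/
def S (x : M) : TangentSpace 𝓘(ℝ, E) x →L[ℝ] TangentSpace 𝓘(ℝ, E) x :=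
  s.φ x ∘L leviCivita s.g s.ξ x

/-- The Lie derivative `(ℒ_ξ φ)Y = [ξ, φY] - φ[ξ, Y]` on vector fields. -/
def lieXiPhi (Y : Π x : M, TangentSpace 𝓘(ℝ, E) x) (x : M) : TangentSpace 𝓘(ℝ, E) x :=
  mlieBracket 𝓘(ℝ, E) s.ξ (fun y ↦ s.φ y (Y y)) x - s.φ x (mlieBracket 𝓘(ℝ, E) s.ξ Y x)

theorem lieXiPhi_tensorial (x : M) : TensorialAt 𝓘(ℝ, E) E (fun Y ↦ s.lieXiPhi Y x) x where
  smul {f Y} hf hY := by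
    have e : (fun y ↦ s.φ y ((f • Y) y)) = f • (fun y ↦ s.φ y (Y y)) := by
      ext y; simp
    simp only [lieXiPhi]
    rw [e, mlieBracket_smul_right hf (s.φ_mdifferentiableAt hY), mlieBracket_smul_right hf hY]
    simp [smul_sub]
  add {Y Y'} hY hY' := by
    have e : (fun y ↦ s.φ y ((Y + Y') y)) = (fun y ↦ s.φ y (Y y)) + (fun y ↦ s.φ y (Y' y)) := by
      ext y; simp
    simp only [lieXiPhi]
    rw [e, mlieBracket_add_right (s.φ_mdifferentiableAt hY) (s.φ_mdifferentiableAt hY'),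
      mlieBracket_add_right hY hY']
    simp
    abel

/-- The intrinsic endomorphism `h = (1/2) ℒ_ξ φ`. -/
def h (x : M) : TangentSpace 𝓘(ℝ, E) x →L[ℝ] TangentSpace 𝓘(ℝ, E) x :=
  (1 / 2 : ℝ) • TensorialAt.mkHom (I := 𝓘(ℝ, E)) (F := E) (fun Y ↦ s.lieXiPhi Y x) x
    (s.lieXiPhi_tensorial x)

/-- `X̃ = (S² - hS)X`. -/
def tilde (x : M) (v : TangentSpace 𝓘(ℝ, E) x) : TangentSpace 𝓘(ℝ, E) x :=
  s.S x (s.S x v) - s.h x (s.S x v)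

/-- A characteristic connection: a smooth connection that parallelizes `g`, `φ`, `ξ`, `η`, and whose
torsion `g(T(X, Y), Z)` is totally skew-symmetric (it always is skew-symmetric in `X`, `Y`). -/
structure IsCharacteristic
    (D : CovariantDerivative 𝓘(ℝ, E) E (fun x : M ↦ TangentSpace 𝓘(ℝ, E) x)) : Prop where
  smooth : D.ContMDiffCovariantDerivative ∞
  metric : ∀ {x : M} {Y Z : Π x : M, TangentSpace 𝓘(ℝ, E) x}, MDiffAt (T% Y) x → MDiffAt (T% Z) x →
    ∀ u, d% (fun y ↦ s.g.inner y (Y y) (Z y)) x u =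
      s.g.inner x (D Y x u) (Z x) + s.g.inner x (Y x) (D Z x u)
  nabla_φ : ∀ {x : M} {Y : Π x : M, TangentSpace 𝓘(ℝ, E) x}, MDiffAt (T% Y) x →
    ∀ u, D (fun y ↦ s.φ y (Y y)) x u - s.φ x (D Y x u) = 0
  nabla_ξ : ∀ (x : M) u, D s.ξ x u = 0
  nabla_η : ∀ {x : M} {Y : Π x : M, TangentSpace 𝓘(ℝ, E) x}, MDiffAt (T% Y) x →
    ∀ u, d% (fun y ↦ s.η y (Y y)) x u - s.η x (D Y x u) = 0
  skew : ∀ (x : M) u v w, s.g.inner x (D.torsion x u v) w = -s.g.inner x (D.torsion x u w) v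

end AlmostContactMetric

/-- Smooth vector fields. -/
def IsSmoothField {E : Type*} [NormedAddCommGroup E] [NormedSpace ℝ E]
    {M : Type*} [TopologicalSpace M] [ChartedSpace E M] [IsManifold 𝓘(ℝ, E) ∞ M]
    (X : Π x : M, TangentSpace 𝓘(ℝ, E) x) : Prop :=
  ContMDiff 𝓘(ℝ, E) (𝓘(ℝ, E).prod 𝓘(ℝ, E)) ∞ (fun x ↦ TotalSpace.mk' E x (X x))

/-- The torsion `T` of the connection `D` is parallel with respect to `D`:
`(∇_X T)(Y, Z) = ∇_X (T(Y, Z)) - T(∇_X Y, Z) - T(Y, ∇_X Z)` vanishes for all smooth vector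
fields. -/
def HasParallelTorsion {E : Type*} [NormedAddCommGroup E] [NormedSpace ℝ E]
    [FiniteDimensional ℝ E]
    {M : Type*} [TopologicalSpace M] [ChartedSpace E M] [IsManifold 𝓘(ℝ, E) ∞ M]
    (D : CovariantDerivative 𝓘(ℝ, E) E (fun x : M ↦ TangentSpace 𝓘(ℝ, E) x)) : Prop :=
  ∀ X Y Z : Π x : M, TangentSpace 𝓘(ℝ, E) x, IsSmoothField X → IsSmoothField Y →
    IsSmoothField Z → ∀ x, D (fun y ↦ D.torsion y (Y y) (Z y)) x (X x)
      - D.torsion x (D Y x (X x)) (Z x) - D.torsion x (Y x) (D Z x (X x)) = 0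

end

noncomputable section

/-! Write `A = ∇^g ξ`. Since `D` is metric with totally skew torsion `T`, the Koszul formula gives
`∇^g = D - T/2`. Together with `Dξ = 0` this yields `T(ξ, u) = 2Au` and makes `A` skew-adjoint with
`Aξ = 0` and `η ∘ A = 0`. Since `Dφ = 0`, the tensor `∇^g Φ` is algebraic in `T`, and being
`ℋ`-parallel forces `T` to vanish on `ℋ` (`inner_torsion_horizontal`). So `T` is built from `η`,
`ξ`, `g` and `A` alone (`torsion_eq`), and since `D` parallelizes the first three, `DT = 0` is
equivalent to `DA = 0` (`hasParallelTorsion_iff`).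

Moreover `h = φA - Aφ`, so `S² - hS = Aφ²A = -A²`. Expanding the curvature through `∇^g = D - T/2`
gives (`riemannCurvature_ξ`) `R(X, Y)ξ = η(Y)X̃ - η(X)Ỹ + (D_X A)Y - (D_Y A)X`. Hence (iii) says
that `g((D_X A)Y, Z)` is symmetric in `X, Y`. It is also skew in `Y, Z`, and a trilinear form with
both symmetries is zero, so (iii) amounts to `DA = 0`, that is, to (i). Conditions (ii) and (iii)
are exchanged by the pair symmetry `g(R(ξ, X)Y, Z) = g(R(Y, Z)ξ, X)`, because `X ↦ X̃` is
self-adjoint.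

For the classes, the endomorphism `h_α` of `α = ∇^g Φ` is the geometric `h` (`formH_eq`). It
vanishes on `𝒞₆ ⊕ 𝒞₇` and equals `2S` on `𝒞_min`, which gives the two values of `S² - hS`. -/

theorem minSmoothness_three_le : minSmoothness ℝ 3 ≤ ∞ := by
  rw [minSmoothness_of_isRCLikeNormedField]
  exact WithTop.coe_le_coe.2 (le_top : (3 : ℕ∞) ≤ ⊤)

theorem minSmoothness_two_le : minSmoothness ℝ 2 ≤ ∞ := by
  rw [minSmoothness_of_isRCLikeNormedField]
  exact WithTop.coe_le_coe.2 (le_top : (2 : ℕ∞) ≤ ⊤)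

/-! ### Smooth vector fields and their brackets -/

section SmoothFields

variable {E : Type*} [NormedAddCommGroup E] [NormedSpace ℝ E]
  {M : Type*} [TopologicalSpace M] [ChartedSpace E M] [IsManifold 𝓘(ℝ, E) ∞ M]
  {X Y Z : Π x : M, TangentSpace 𝓘(ℝ, E) x}

namespace IsSmoothField

theorem mdiffAt (hX : IsSmoothField X) (x : M) : MDiffAt (T% X) x :=
  ContMDiff.mdifferentiableAt hX (by simp)

theorem add (hX : IsSmoothField X) (hY : IsSmoothField Y) : IsSmoothField (X + Y) :=
  ContMDiff.add_section hX hY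

theorem const_smul (c : ℝ) (hX : IsSmoothField X) : IsSmoothField (c • X) :=
  ContMDiff.const_smul_section hX

theorem smul {f : M → ℝ} (hf : CMDiff ∞ f) (hX : IsSmoothField X) : IsSmoothField (f • X) :=
  ContMDiff.smul_section hf hX

theorem inner (g : SmoothMetric E M) (hX : IsSmoothField X) (hY : IsSmoothField Y) :
    CMDiff ∞ (fun y ↦ g.inner y (X y) (Y y)) := by
  intro x
  have h := ContMDiffAt.clm_bundle_apply₂ (F₁ := E) (F₂ := E) (g.contMDiff x) (hX x) (hY x)
  simp only [contMDiffAt_totalSpace] at h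
  exact h.2

theorem clm_apply {L : Π x : M, TangentSpace 𝓘(ℝ, E) x →L[ℝ] TangentSpace 𝓘(ℝ, E) x}
    (hL : ContMDiff 𝓘(ℝ, E) (𝓘(ℝ, E).prod 𝓘(ℝ, E →L[ℝ] E)) ∞
      (fun x ↦ TotalSpace.mk' (E →L[ℝ] E) x (L x)))
    (hX : IsSmoothField X) : IsSmoothField (fun y ↦ L y (X y)) :=
  ContMDiff.clm_bundle_apply (F₁ := E) (F₂ := E) hL hX

/-- Every tangent vector extends to a smooth vector field. -/
theorem exists_extension [FiniteDimensional ℝ E] [T2Space M] {x : M}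
    (v : TangentSpace 𝓘(ℝ, E) x) :
    ∃ X : Π x : M, TangentSpace 𝓘(ℝ, E) x, IsSmoothField X ∧ X x = v := by
  obtain ⟨t, ht, hsm⟩ := FiberBundle.exists_contMDiffOn_extend (k := ∞) 𝓘(ℝ, E) E v
  obtain ⟨u, hut, hu, hxu⟩ := mem_nhds_iff.1 ht
  obtain ⟨f, -, hf⟩ := (SmoothBumpFunction.nhds_basis_tsupport (I := 𝓘(ℝ, E)) x).mem_iff.1
    (hu.mem_nhds hxu)
  exact ⟨(f : M → ℝ) • FiberBundle.extend E v,
    ContMDiffOn.smul_section_of_tsupport f.contMDiff.contMDiffOn hu hf (hsm.mono hut),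
    by simp⟩

variable [CompleteSpace E]

theorem mlieBracket (hX : IsSmoothField X) (hY : IsSmoothField Y) :
    IsSmoothField (VectorField.mlieBracket 𝓘(ℝ, E) X Y) := fun x ↦
  have : IsManifold 𝓘(ℝ, E) ((⊤ : ℕ∞) + 1) M := inferInstanceAs (IsManifold 𝓘(ℝ, E) ∞ M)
  have : IsManifold 𝓘(ℝ, E) (minSmoothness ℝ 2) M :=
    IsManifold.of_le (n := ∞) minSmoothness_two_le
  ContMDiffAt.mlieBracket_vectorField (m := ⊤) (n := ⊤) (hX x) (hY x) (by simp)

theorem jacobi (hX : IsSmoothField X) (hY : IsSmoothField Y) (hZ : IsSmoothField Z) (x : M) :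
    VectorField.mlieBracket 𝓘(ℝ, E) X (VectorField.mlieBracket 𝓘(ℝ, E) Y Z) x =
      VectorField.mlieBracket 𝓘(ℝ, E) (VectorField.mlieBracket 𝓘(ℝ, E) X Y) Z x +
        VectorField.mlieBracket 𝓘(ℝ, E) Y (VectorField.mlieBracket 𝓘(ℝ, E) X Z) x := by
  have h : minSmoothness ℝ 2 ≤ ∞ := minSmoothness_two_le
  have : IsManifold 𝓘(ℝ, E) (minSmoothness ℝ 3) M :=
    IsManifold.of_le (n := ∞) minSmoothness_three_le
  exact leibniz_identity_mlieBracket_apply ((hX x).of_le h) ((hY x).of_le h) ((hZ x).of_le h)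

/-- `X(Yf) - Y(Xf) = [X, Y]f`, derived from the Jacobi identity for `X`, `Y`, `fZ` with `Z` a field
that does not vanish at the point considered. -/
theorem mvfderiv_mlieBracket (hX : IsSmoothField X) (hY : IsSmoothField Y) (hZ : IsSmoothField Z)
    {f : M → ℝ} (hf : CMDiff ∞ f) {x : M} (hXf : MDiffAt (fun y ↦ d% f y (X y)) x)
    (hYf : MDiffAt (fun y ↦ d% f y (Y y)) x) (hZx : Z x ≠ 0) :
    d% f x (VectorField.mlieBracket 𝓘(ℝ, E) X Y x) =
      d% (fun y ↦ d% f y (Y y)) x (X x) - d% (fun y ↦ d% f y (X y)) x (Y x) := by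
  have hf' (y : M) : MDiffAt f y := (hf y).mdifferentiableAt (by simp)
  -- In `[V, [W, fZ]]` the two mixed terms are exchanged when `V` and `W` are, so they cancel in the
  -- Jacobi identity; the terms carrying `f` itself cancel by the Jacobi identity for `Z`. Only
  -- multiples of `Z` remain.
  have key (V W : Π x : M, TangentSpace 𝓘(ℝ, E) x) (hW : IsSmoothField W)
      (hWf : MDiffAt (fun y ↦ d% f y (W y)) x) :
      VectorField.mlieBracket 𝓘(ℝ, E) V (VectorField.mlieBracket 𝓘(ℝ, E) W (f • Z)) x =
        d% (fun y ↦ d% f y (W y)) x (V x) • Z x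
          + d% f x (W x) • VectorField.mlieBracket 𝓘(ℝ, E) V Z x
          + d% f x (V x) • VectorField.mlieBracket 𝓘(ℝ, E) W Z x
          + f x • VectorField.mlieBracket 𝓘(ℝ, E) V (VectorField.mlieBracket 𝓘(ℝ, E) W Z) x := by
    have e : VectorField.mlieBracket 𝓘(ℝ, E) W (f • Z) =
        (fun y ↦ d% f y (W y)) • Z + f • VectorField.mlieBracket 𝓘(ℝ, E) W Z := by
      ext y
      rw [mlieBracket_smul_right (hf' y) (hZ.mdiffAt y)]
      rfl
    rw [e, mlieBracket_add_right (hWf.smul_section (hZ.mdiffAt x))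
      ((hf' x).smul_section ((hW.mlieBracket hZ).mdiffAt x)),
      mlieBracket_smul_right hWf (hZ.mdiffAt x),
      mlieBracket_smul_right (hf' x) ((hW.mlieBracket hZ).mdiffAt x)]
    module
  have h1 := hX.jacobi hY (hZ.smul hf) x
  rw [key X Y hY hYf, key Y X hX hXf, mlieBracket_smul_right (hf' x) (hZ.mdiffAt x),
    hX.jacobi hY hZ x] at h1
  have h2 : (d% f x (VectorField.mlieBracket 𝓘(ℝ, E) X Y x) -
      (d% (fun y ↦ d% f y (Y y)) x (X x) - d% (fun y ↦ d% f y (X y)) x (Y x))) • Z x = 0 := by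
    linear_combination (norm := module) -h1
  exact sub_eq_zero.1 ((smul_eq_zero.1 h2).resolve_right hZx)

end IsSmoothField

end SmoothFields

/-! ### Symmetries of the Riemannian curvature -/

section Curvature

variable {E : Type*} [NormedAddCommGroup E] [NormedSpace ℝ E] [FiniteDimensional ℝ E]
  {M : Type*} [TopologicalSpace M] [ChartedSpace E M] [IsManifold 𝓘(ℝ, E) ∞ M]
  (g : SmoothMetric E M) {X Y Z W N : Π x : M, TangentSpace 𝓘(ℝ, E) x}

theorem leviCivita_sub_swap {x : M} (hX : MDiffAt (T% X) x) (hY : MDiffAt (T% Y) x) :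
    leviCivita g Y x (X x) - leviCivita g X x (Y x) = mlieBracket 𝓘(ℝ, E) X Y x :=
  (leviCivita g).torsion_eq_zero_iff.1 (leviCivita_torsion g) hX hY

omit [FiniteDimensional ℝ E] in
theorem CovariantDerivative.apply_sub
    (D : CovariantDerivative 𝓘(ℝ, E) E (fun x : M ↦ TangentSpace 𝓘(ℝ, E) x)) {x : M}
    (hX : MDiffAt (T% X) x) (hY : MDiffAt (T% Y) x) :
    D (fun y ↦ X y - Y y) x = D X x - D Y x := by
  have e : (fun y ↦ X y - Y y) = X + (-1 : ℝ) • Y := by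
    ext y; simp [sub_eq_add_neg]
  rw [e, D.isCovariantDerivativeOn.add hX (MDifferentiableAt.smul_const_section hY),
    D.isCovariantDerivativeOn.smul_const (-1 : ℝ) hY]
  module

theorem riemannCurvature_swap (x : M) :
    riemannCurvature g X Y Z x = -riemannCurvature g Y X Z x := by
  rw [riemannCurvature, riemannCurvature, mlieBracket_swap_apply (V := X)]
  simp only [map_neg]
  module

/-- The Levi-Civita connection maps smooth fields to smooth fields. -/
def PreservesSmooth : Prop :=
  ∀ ⦃X Y : Π x : M, TangentSpace 𝓘(ℝ, E) x⦄, IsSmoothField X → IsSmoothField Y →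
    IsSmoothField (fun y ↦ leviCivita g Y y (X y))

variable {g}

/-- As `∇^g` is torsion-free, the cyclic sum regroups into iterated brackets `[U, [V, W]]`, and the
Jacobi identity finishes. -/
theorem riemannCurvature_bianchi (hg : PreservesSmooth g) (hX : IsSmoothField X)
    (hY : IsSmoothField Y) (hZ : IsSmoothField Z) (x : M) :
    riemannCurvature g X Y Z x + riemannCurvature g Y Z X x + riemannCurvature g Z X Y x = 0 := by
  have key (U V W : Π x : M, TangentSpace 𝓘(ℝ, E) x) (hU : IsSmoothField U)
      (hV : IsSmoothField V) (hW : IsSmoothField W) :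
      leviCivita g (fun y ↦ leviCivita g W y (V y)) x (U x)
        - leviCivita g (fun y ↦ leviCivita g V y (W y)) x (U x)
        - leviCivita g U x (mlieBracket 𝓘(ℝ, E) V W x) =
      mlieBracket 𝓘(ℝ, E) U (mlieBracket 𝓘(ℝ, E) V W) x := by
    have e : mlieBracket 𝓘(ℝ, E) V W =
        fun y ↦ leviCivita g W y (V y) - leviCivita g V y (W y) := by
      ext y
      exact (leviCivita_sub_swap g (hV.mdiffAt y) (hW.mdiffAt y)).symm
    rw [← leviCivita_sub_swap g (hU.mdiffAt x) ((hV.mlieBracket hW).mdiffAt x), e,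
      CovariantDerivative.apply_sub _ ((hg hV hW).mdiffAt x) ((hg hW hV).mdiffAt x)]
    rfl
  have h1 := key X Y Z hX hY hZ
  have h2 := key Y Z X hY hZ hX
  have h3 := key Z X Y hZ hX hY
  have h4 := hX.jacobi hY hZ x
  rw [mlieBracket_swap_apply (V := mlieBracket 𝓘(ℝ, E) X Y),
    mlieBracket_swap (V := X) (W := Z)] at h4
  have h5 : mlieBracket 𝓘(ℝ, E) Y (-mlieBracket 𝓘(ℝ, E) Z X) x =
      -mlieBracket 𝓘(ℝ, E) Y (mlieBracket 𝓘(ℝ, E) Z X) x := by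
    have := mlieBracket_const_smul_right (c := (-1 : ℝ)) (V := Y)
      ((hZ.mlieBracket hX).mdiffAt x)
    simpa using this
  rw [h5] at h4
  simp only [riemannCurvature]
  linear_combination (norm := module) h1 + h2 + h3 + h4

/-- Differentiate the function `g(Z, W)` twice with the metric property and compare with `[X, Y]`
acting as a commutator. The field `N` only supplies the nonvanishing field which that commutator
formula needs; in the application it is `ξ`. -/
theorem inner_riemannCurvature_skew (hg : PreservesSmooth g) (hX : IsSmoothField X)
    (hY : IsSmoothField Y) (hZ : IsSmoothField Z) (hW : IsSmoothField W) (hN : IsSmoothField N)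
    {x : M} (hNx : N x ≠ 0) :
    g.inner x (riemannCurvature g X Y Z x) (W x) =
      -g.inner x (riemannCurvature g X Y W x) (Z x) := by
  have d1 (U : Π x : M, TangentSpace 𝓘(ℝ, E) x) (hU : IsSmoothField U) :
      (fun y ↦ d% (fun y ↦ g.inner y (Z y) (W y)) y (U y)) =
        fun y ↦ g.inner y (leviCivita g Z y (U y)) (W y)
          + g.inner y (Z y) (leviCivita g W y (U y)) := by
    ext y
    exact leviCivita_metric g (hU.mdiffAt y) (hZ.mdiffAt y) (hW.mdiffAt y)
  have sm (U : Π x : M, TangentSpace 𝓘(ℝ, E) x) (hU : IsSmoothField U) :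
      MDiffAt (fun y ↦ d% (fun y ↦ g.inner y (Z y) (W y)) y (U y)) x := by
    rw [d1 U hU]
    exact (g.mdifferentiableAt ((hg hU hZ).mdiffAt x) (hW.mdiffAt x)).add
      (g.mdifferentiableAt (hZ.mdiffAt x) ((hg hU hW).mdiffAt x))
  have d2 (U V : Π x : M, TangentSpace 𝓘(ℝ, E) x) (hU : IsSmoothField U) (hV : IsSmoothField V) :
      d% (fun y ↦ d% (fun y ↦ g.inner y (Z y) (W y)) y (U y)) x (V x) =
        g.inner x (leviCivita g (fun y ↦ leviCivita g Z y (U y)) x (V x)) (W x)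
        + g.inner x (leviCivita g Z x (U x)) (leviCivita g W x (V x))
        + g.inner x (leviCivita g Z x (V x)) (leviCivita g W x (U x))
        + g.inner x (Z x) (leviCivita g (fun y ↦ leviCivita g W y (U y)) x (V x)) := by
    rw [d1 U hU, mvfderiv_fun_add
      (g.mdifferentiableAt ((hg hU hZ).mdiffAt x) (hW.mdiffAt x))
      (g.mdifferentiableAt (hZ.mdiffAt x) ((hg hU hW).mdiffAt x)), add_apply,
      leviCivita_metric g (hV.mdiffAt x) ((hg hU hZ).mdiffAt x) (hW.mdiffAt x),
      leviCivita_metric g (hV.mdiffAt x) (hZ.mdiffAt x) ((hg hU hW).mdiffAt x)]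
    ring
  have h1 := hX.mvfderiv_mlieBracket hY hN (hZ.inner g hW) (sm X hX) (sm Y hY) hNx
  rw [d2 X Y hX hY, d2 Y X hY hX,
    leviCivita_metric g ((hX.mlieBracket hY).mdiffAt x) (hZ.mdiffAt x) (hW.mdiffAt x)] at h1
  rw [g.symm x (riemannCurvature g X Y W x)]
  simp only [riemannCurvature, map_sub, sub_apply]
  linear_combination -h1

/-- The classical octahedron argument: the four Bianchi identities for the cyclic shifts of `(X, Y,
Z, W)`, combined using skewness in each pair. -/
theorem inner_riemannCurvature_pair_symm (hg : PreservesSmooth g) (hX : IsSmoothField X)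
    (hY : IsSmoothField Y) (hZ : IsSmoothField Z) (hW : IsSmoothField W) (hN : IsSmoothField N)
    {x : M} (hNx : N x ≠ 0) :
    g.inner x (riemannCurvature g X Y Z x) (W x) =
      g.inner x (riemannCurvature g Z W X x) (Y x) := by
  have b (U V W' N' : Π x : M, TangentSpace 𝓘(ℝ, E) x) (hU : IsSmoothField U)
      (hV : IsSmoothField V) (hW' : IsSmoothField W') :
      g.inner x (riemannCurvature g U V W' x) (N' x)
        + g.inner x (riemannCurvature g V W' U x) (N' x)
        + g.inner x (riemannCurvature g W' U V x) (N' x) = 0 := by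
    rw [← add_apply, ← add_apply, ← map_add, ← map_add, riemannCurvature_bianchi hg hU hV hW']
    simp
  have sk (U V W' N' : Π x : M, TangentSpace 𝓘(ℝ, E) x) (hU : IsSmoothField U)
      (hV : IsSmoothField V) (hW' : IsSmoothField W') (hN' : IsSmoothField N') :=
    inner_riemannCurvature_skew hg hU hV hW' hN' hN hNx
  have sw (U V W' N' : Π x : M, TangentSpace 𝓘(ℝ, E) x) :
      g.inner x (riemannCurvature g U V W' x) (N' x) =
        -g.inner x (riemannCurvature g V U W' x) (N' x) := by
    rw [riemannCurvature_swap, map_neg, neg_apply]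
  have b1 := b X Y Z W hX hY hZ
  have b2 := b Y Z W X hY hZ hW
  have b3 := b Z W X Y hZ hW hX
  have b4 := b W X Y Z hW hX hY
  have s1 := sk Y Z X W hY hZ hX hW
  have s2 := sk Z X Y W hZ hX hY hW
  have s3 := sk X Y Z W hX hY hZ hW
  have s4 := sk Z W Y X hZ hW hY hX
  have s5 := sk W Y Z X hW hY hZ hX
  have s6 := sk W X Z Y hW hX hZ hY
  have w1 := sw X Z W Y
  have w2 := sw Y W X Z
  linarith

end Curvature

/-! ### Pointwise algebra of almost contact metric structures -/

namespace LinearACM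

variable {V : Type*} [AddCommGroup V] [Module ℝ V] (A : LinearACM V)

theorem ξ_ne_zero : A.ξ ≠ 0 := fun h ↦ by
  have := A.η_ξ
  simp [h] at this

/-- From `φ²ξ = 0`, the axiom for `φ²` at `φξ` shows that `φξ` is a multiple of `ξ`; applying `φ`
once more makes that multiple zero. -/
theorem φ_ξ : A.φ A.ξ = 0 := by
  have h1 : A.φ (A.φ A.ξ) = 0 := by simp [A.φ_sq, A.η_ξ]
  have h2 := A.φ_sq (A.φ A.ξ)
  rw [h1, map_zero] at h2
  have h3 : A.φ A.ξ = A.η (A.φ A.ξ) • A.ξ := by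
    linear_combination (norm := module) h2
  have h4 := congrArg A.φ h3
  rw [h1, map_smul, eq_comm, smul_eq_zero] at h4
  rcases h4 with h4 | h4
  · rw [h3, h4, zero_smul]
  · exact h4

theorem η_φ (v : V) : A.η (A.φ v) = 0 := by
  have h1 := A.φ_sq (A.φ v)
  rw [A.φ_sq v, map_add, map_neg, map_smul, A.φ_ξ, smul_zero, add_zero] at h1
  exact (smul_eq_zero.1 (left_eq_add.1 h1)).resolve_right A.ξ_ne_zero

theorem g_ξ (v : V) : A.g A.ξ v = A.η v := by
  have h := A.g_φ A.ξ v
  rw [A.φ_ξ, A.η_ξ] at h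
  simp only [map_zero, LinearMap.zero_apply] at h
  linarith

theorem g_φ_left (u v : V) : A.g (A.φ u) v = -A.g u (A.φ v) := by
  have h := A.g_φ (A.φ u) v
  rw [A.φ_sq, A.η_φ] at h
  simp only [map_add, map_neg, map_smul, LinearMap.add_apply, LinearMap.neg_apply,
    LinearMap.smul_apply, A.g_ξ, A.η_φ, smul_zero, zero_mul] at h
  linarith

/-- The trace condition in `classC6` quantifies over all orthonormal bases, so one basis is needed
to extract its formula. -/
theorem exists_isOrthonormalBasis [FiniteDimensional ℝ V] {m : ℕ} (hm : Module.finrank ℝ V = m) :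
    ∃ e : Module.Basis (Fin m) ℝ V, A.IsOrthonormalBasis e := by
  subst hm
  obtain ⟨v, hv⟩ := LinearMap.BilinForm.exists_orthogonal_basis (B := A.g) ⟨A.g_symm⟩
  have hpos (i) : 0 < A.g (v i) (v i) := A.g_pos _ (v.ne_zero i)
  have hw (i) : IsUnit (√(A.g (v i) (v i)))⁻¹ :=
    (inv_ne_zero (Real.sqrt_pos.2 (hpos i)).ne').isUnit
  refine ⟨v.isUnitSMul hw, fun i ↦ ?_, fun i j hij ↦ ?_⟩
  · have h := Real.mul_self_sqrt (hpos i).le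
    have h0 := (Real.sqrt_pos.2 (hpos i)).ne'
    simp only [Module.Basis.isUnitSMul_apply, map_smul, LinearMap.smul_apply, smul_eq_mul]
    field_simp
    linarith
  · have h : A.g (v i) (v j) = 0 := hv hij
    simp [Module.Basis.isUnitSMul_apply, h]

theorem formH_add (α β : Trilinear V) (Y Z : V) :
    A.formH (α + β) Y Z = A.formH α Y Z + A.formH β Y Z := by
  simp only [formH, formS, formP, LinearMap.add_apply]
  ring

/-- Here `α` is a multiple of `η(Y)g(X,Z) - η(Z)g(X,Y)`. Thus `P = 0`, and the form of `S` is a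
multiple of `g - η ⊗ η`, hence `φ`-invariant; whatever the multiple, the terms of `formH` cancel. -/
theorem formH_of_mem_classC6 [FiniteDimensional ℝ V] {n : ℕ}
    (hn : Module.finrank ℝ V = 2 * n + 1) {α : Trilinear V} (hα : α ∈ A.classC6 n) (Y Z : V) :
    A.formH α Y Z = 0 := by
  obtain ⟨e, he⟩ := A.exists_isOrthonormalBasis hn
  have h := hα.2 e he
  rw [formH, formS, formS, formP, h (A.φ Y), h Y, h A.ξ]
  simp only [A.g_φ, A.η_ξ, A.η_φ, A.g_ξ, A.g_symm _ A.ξ]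
  ring

/-- Putting `ξ` in the first slot of the defining identity gives `P = 0`, since `φξ = 0`; putting it
in the second gives `φ`-invariance of the form of `S`. -/
theorem formH_of_mem_classC7 {n : ℕ} {α : Trilinear V} (hα : α ∈ A.classC7 n) (Y Z : V) :
    A.formH α Y Z = 0 := by
  have h := hα.2.1
  have h1 : α A.ξ A.ξ (A.φ (A.φ Y)) = 0 := by
    rw [h]
    simp [nablaEta, A.φ_ξ, A.η_φ]
  have hS : A.formS α Y Z = A.formS α (A.φ Y) (A.φ Z) := by
    rw [formS, formS, h Y A.ξ Z]
    simp [nablaEta, A.η_ξ, h1]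
  have hP : A.formP α Y Z = 0 := by
    rw [formP, h]
    simp [nablaEta, A.φ_ξ]
  rw [formH, hS, hP]
  ring

theorem formH_of_mem_classC6C7 [FiniteDimensional ℝ V] {n : ℕ}
    (hn : Module.finrank ℝ V = 2 * n + 1) {α : Trilinear V} (hα : α ∈ A.classC6C7 n) (Y Z : V) :
    A.formH α Y Z = 0 := by
  obtain ⟨β, hβ, γ, hγ, rfl⟩ := Submodule.mem_sup.1 hα
  rw [formH_add, A.formH_of_mem_classC6 hn hβ, A.formH_of_mem_classC7 hγ, add_zero]

end LinearACM

/-! ### The torsion, `h` and `X̃` in terms of `∇^g ξ` -/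

namespace AlmostContactMetric

variable {E : Type*} [NormedAddCommGroup E] [NormedSpace ℝ E]
  {M : Type*} [TopologicalSpace M] [ChartedSpace E M] [IsManifold 𝓘(ℝ, E) ∞ M]
  (s : AlmostContactMetric E M)

theorem ξ_mdiffAt (x : M) : MDiffAt (T% s.ξ) x :=
  IsSmoothField.mdiffAt (X := s.ξ) s.ξ_smooth x

section Pointwise

variable (x : M) (u v : TangentSpace 𝓘(ℝ, E) x)

theorem ξ_ne_zero : s.ξ x ≠ 0 := (s.atPoint x).ξ_ne_zero

theorem φ_ξ : s.φ x (s.ξ x) = 0 := (s.atPoint x).φ_ξ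

theorem η_φ : s.η x (s.φ x v) = 0 := (s.atPoint x).η_φ v

theorem inner_ξ : s.g.inner x (s.ξ x) v = s.η x v := (s.atPoint x).g_ξ v

theorem inner_ξ_right : s.g.inner x v (s.ξ x) = s.η x v := by
  rw [s.g.symm, s.inner_ξ]

theorem inner_φ_left : s.g.inner x (s.φ x u) v = -s.g.inner x u (s.φ x v) :=
  (s.atPoint x).g_φ_left u v

variable {x u v} in
theorem ext_inner_right (h : ∀ w, s.g.inner x u w = s.g.inner x v w) : u = v := by
  by_contra hne
  have h1 := s.g.pos x (u - v) (sub_ne_zero.2 hne)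
  have h2 := h (u - v)
  simp only [map_sub, sub_apply] at h1 h2
  linarith

end Pointwise

variable [FiniteDimensional ℝ E]
  {D : CovariantDerivative 𝓘(ℝ, E) E (fun x : M ↦ TangentSpace 𝓘(ℝ, E) x)}

/-- The endomorphism `∇^g ξ`. -/
abbrev nablaXi (x : M) : TangentSpace 𝓘(ℝ, E) x →L[ℝ] TangentSpace 𝓘(ℝ, E) x :=
  leviCivita s.g s.ξ x

variable (D) in
theorem inner_torsion_swap_left (x : M) (u v w : TangentSpace 𝓘(ℝ, E) x) :
    s.g.inner x (D.torsion x u v) w = -s.g.inner x (D.torsion x v u) w := by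
  rw [D.torsion_antisymm]; simp

namespace IsCharacteristic

variable {s} (hD : s.IsCharacteristic D)

include hD

/-- In the Koszul formula, write each bracket as `D_V W - D_W V - T(V, W)`. The metric property of
`D` removes all derivatives but `2 g(D_X Y, Z)`, and total skewness merges the three torsion terms
into `-T(X, Y, Z)`. -/
theorem leviCivita_eq {x : M} {Y : Π x : M, TangentSpace 𝓘(ℝ, E) x} (hY : MDiffAt (T% Y) x)
    (u : TangentSpace 𝓘(ℝ, E) x) :
    leviCivita s.g Y x u = D Y x u - (1 / 2 : ℝ) • D.torsion x u (Y x) := by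
  obtain ⟨X, hX, rfl⟩ : ∃ X : Π x : M, TangentSpace 𝓘(ℝ, E) x, MDiffAt (T% X) x ∧ X x = u :=
    ⟨FiberBundle.extend E u, FiberBundle.mdifferentiableAt_extend .., by simp⟩
  apply s.g.ext_inner
  intro Z hZ
  have hb (V W : Π x : M, TangentSpace 𝓘(ℝ, E) x) (hV : MDiffAt (T% V) x)
      (hW : MDiffAt (T% W) x) :
      mlieBracket 𝓘(ℝ, E) V W x = D W x (V x) - D V x (W x) - D.torsion x (V x) (W x) := by
    rw [D.torsion_apply hV hW]; abel
  rw [inner_leviCivita s.g hX hY hZ, koszul, hD.metric hY hZ, hD.metric hX hZ, hD.metric hX hY,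
    hb X Y hX hY, hb X Z hX hZ, hb Y Z hY hZ]
  have t1 := hD.skew x (X x) (Z x) (Y x)
  have t2 := hD.skew x (Y x) (Z x) (X x)
  have t3 := D.torsion_antisymm (X x) (Y x)
  simp only [map_sub, sub_apply, map_smul, smul_apply, smul_eq_mul]
  rw [t1, t2, t3, s.g.symm x (Y x) (D Z x (X x)), s.g.symm x (X x) (D Z x (Y x)),
    s.g.symm x (X x) (D Y x (Z x))]
  simp only [map_neg, neg_apply]
  ring

theorem nablaXi_apply (x : M) (u : TangentSpace 𝓘(ℝ, E) x) :
    s.nablaXi x u = (1 / 2 : ℝ) • D.torsion x (s.ξ x) u := by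
  rw [hD.leviCivita_eq (s.ξ_mdiffAt x), hD.nabla_ξ, D.torsion_antisymm]
  module

theorem nablaPhi_apply (x : M) (u v w : TangentSpace 𝓘(ℝ, E) x) :
    s.nablaPhi x v w u = (1 / 2 : ℝ) * (s.g.inner x (D.torsion x u v) (s.φ x w)
      - s.g.inner x (D.torsion x u w) (s.φ x v)) := by
  obtain ⟨V, hV, rfl⟩ : ∃ X : Π x : M, TangentSpace 𝓘(ℝ, E) x, MDiffAt (T% X) x ∧ X x = v :=
    ⟨FiberBundle.extend E v, FiberBundle.mdifferentiableAt_extend .., by simp⟩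
  obtain ⟨W, hW, rfl⟩ : ∃ X : Π x : M, TangentSpace 𝓘(ℝ, E) x, MDiffAt (T% X) x ∧ X x = w :=
    ⟨FiberBundle.extend E w, FiberBundle.mdifferentiableAt_extend .., by simp⟩
  have h1 : s.nablaPhi x (V x) (W x) = s.nablaPhiAux V W x :=
    TensorialAt.mkHom₂_apply (I := 𝓘(ℝ, E)) (F := E) (F' := E)
      (Φ := fun Y Z ↦ s.nablaPhiAux Y Z x) _ _ hV hW
  have h2 := hD.nabla_φ hW u
  rw [sub_eq_zero] at h2
  rw [h1, nablaPhiAux]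
  simp only [sub_apply, ContinuousLinearMap.comp_apply]
  rw [hD.metric hV (s.φ_mdifferentiableAt hW), h2, hD.leviCivita_eq hV, hD.leviCivita_eq hW,
    s.g.symm x (s.φ x (W x))]
  simp only [map_sub, sub_apply, map_smul, smul_apply, smul_eq_mul]
  rw [s.g.symm x (V x) (s.φ x (D.torsion x u (W x))), s.inner_φ_left]
  ring

theorem inner_torsion_cycle (x : M) (u v w : TangentSpace 𝓘(ℝ, E) x) :
    s.g.inner x (D.torsion x u v) w = s.g.inner x (D.torsion x v w) u := by
  rw [s.inner_torsion_swap_left, hD.skew x v u w, neg_neg]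

theorem inner_torsion_horizontal (hs : s.IsHParallel) (x : M) (u v w : TangentSpace 𝓘(ℝ, E) x)
    (hu : s.η x u = 0) (hv : s.η x v = 0) (hw : s.η x w = 0) :
    s.g.inner x (D.torsion x u v) w = 0 := by
  -- On `ℋ`, moving `φ` from one argument of `T` to another changes the sign.
  have key (a b c : TangentSpace 𝓘(ℝ, E) x) (ha : s.η x a = 0) (hb : s.η x b = 0)
      (hc : s.η x c = 0) :
      s.g.inner x (D.torsion x a b) (s.φ x c) = -s.g.inner x (D.torsion x a (s.φ x b)) c := by
    have h1 := hs x a b c ha hb hc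
    rw [hD.nablaPhi_apply] at h1
    rw [← hD.skew x a c (s.φ x b)]
    linarith
  -- Carrying `φ` once around the three arguments changes the sign three times, so the value equals
  -- its own negative. Taking `a = φu` then removes `φ`, as `φ² = -1` on `ℋ`.
  have main (a : TangentSpace 𝓘(ℝ, E) x) (ha : s.η x a = 0) :
      s.g.inner x (D.torsion x (s.φ x a) v) w = 0 := by
    have k1 := key a v w ha hv hw
    have k2 := key w a v hw ha hv
    have k3 := key v w a hv hw ha
    have c1 := hD.inner_torsion_cycle x w (s.φ x a) v
    have c2 := hD.inner_torsion_cycle x w a (s.φ x v)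
    have c3 := hD.inner_torsion_cycle x (s.φ x a) v w
    have c4 := hD.inner_torsion_cycle x a v (s.φ x w)
    linarith
  have h := main (s.φ x u) (s.η_φ x u)
  rw [s.φ_sq, hu, zero_smul, add_zero] at h
  simpa using h

theorem η_nablaXi (x : M) (u : TangentSpace 𝓘(ℝ, E) x) : s.η x (s.nablaXi x u) = 0 := by
  rw [← s.inner_ξ_right, hD.nablaXi_apply, map_smul, smul_apply, ← hD.inner_torsion_cycle,
    D.torsion_self]
  simp

theorem nablaXi_ξ (x : M) : s.nablaXi x (s.ξ x) = 0 := by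
  rw [hD.nablaXi_apply, D.torsion_self, smul_zero]

theorem inner_nablaXi (x : M) (u v : TangentSpace 𝓘(ℝ, E) x) :
    s.g.inner x (s.nablaXi x u) v = -s.g.inner x u (s.nablaXi x v) := by
  rw [s.g.symm x u, hD.nablaXi_apply, hD.nablaXi_apply, map_smul, map_smul, smul_apply, smul_apply,
    hD.skew]
  simp

/-- The torsion of the characteristic connection is `η ∧ dη`. -/
theorem torsion_eq (hs : s.IsHParallel) (x : M) (u v : TangentSpace 𝓘(ℝ, E) x) :
    D.torsion x u v = (2 : ℝ) • (s.η x u • s.nablaXi x v - s.η x v • s.nablaXi x u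
      + s.g.inner x (s.nablaXi x u) v • s.ξ x) := by
  apply s.ext_inner_right
  intro w
  have h1 (a b : TangentSpace 𝓘(ℝ, E) x) : s.g.inner x (D.torsion x (s.ξ x) a) b =
      2 * s.g.inner x (s.nablaXi x a) b := by
    rw [hD.nablaXi_apply]; simp
  have h2 (a b : TangentSpace 𝓘(ℝ, E) x) : s.g.inner x (D.torsion x a (s.ξ x)) b =
      -(2 * s.g.inner x (s.nablaXi x a) b) := by
    rw [s.inner_torsion_swap_left, h1]
  have h3 (a b : TangentSpace 𝓘(ℝ, E) x) : s.g.inner x (D.torsion x a b) (s.ξ x) =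
      2 * s.g.inner x (s.nablaXi x a) b := by
    rw [hD.skew, h2, neg_neg]
  -- The torsion vanishes on the horizontal parts `a - η(a)ξ`; expanding that identity leaves the
  -- formula.
  have hη (a : TangentSpace 𝓘(ℝ, E) x) : s.η x (a - s.η x a • s.ξ x) = 0 := by
    simp [s.η_ξ]
  have h := hD.inner_torsion_horizontal hs x _ _ _ (hη u) (hη v) (hη w)
  simp only [map_sub, map_smul, sub_apply, smul_apply, smul_eq_mul, h1, h2, h3, hD.nablaXi_ξ,
    map_zero, zero_apply, s.inner_ξ_right, hD.η_nablaXi] at h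
  simp only [map_add, map_sub, map_smul, add_apply, sub_apply, smul_apply, smul_eq_mul, s.inner_ξ]
  linear_combination h

/-- Since `Dξ = 0`, `[ξ, V] = D_ξ V - 2∇^g_V ξ`, and the `D_ξ` terms of `ℒ_ξ φ` cancel by `Dφ = 0`.
-/
theorem h_apply (x : M) (u : TangentSpace 𝓘(ℝ, E) x) :
    s.h x u = s.φ x (s.nablaXi x u) - s.nablaXi x (s.φ x u) := by
  obtain ⟨Y, hY, rfl⟩ : ∃ X : Π x : M, TangentSpace 𝓘(ℝ, E) x, MDiffAt (T% X) x ∧ X x = u :=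
    ⟨FiberBundle.extend E u, FiberBundle.mdifferentiableAt_extend .., by simp⟩
  have h1 : TensorialAt.mkHom (I := 𝓘(ℝ, E)) (F := E) (fun Y ↦ s.lieXiPhi Y x) x
      (s.lieXiPhi_tensorial x) (Y x) = s.lieXiPhi Y x := TensorialAt.mkHom_apply _ hY
  have hb (V : Π x : M, TangentSpace 𝓘(ℝ, E) x) (hV : MDiffAt (T% V) x) :
      mlieBracket 𝓘(ℝ, E) s.ξ V x = D V x (s.ξ x) - (2 : ℝ) • s.nablaXi x (V x) := by
    rw [hD.nablaXi_apply, D.torsion_apply (s.ξ_mdiffAt x) hV, hD.nabla_ξ]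
    module
  have h2 := hD.nabla_φ hY (s.ξ x)
  rw [h, smul_apply, h1, lieXiPhi, hb _ (s.φ_mdifferentiableAt hY), hb _ hY, sub_eq_zero.1 h2,
    map_sub, map_smul]
  module

theorem tilde_apply (x : M) (u : TangentSpace 𝓘(ℝ, E) x) :
    s.tilde x u = -s.nablaXi x (s.nablaXi x u) := by
  simp only [tilde, hD.h_apply, S, ContinuousLinearMap.comp_apply, s.φ_sq, hD.η_nablaXi,
    zero_smul, add_zero, map_neg]
  module

end IsCharacteristic

end AlmostContactMetric

/-! ### The derivative of `∇^g ξ`, curvature and parallel torsion -/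

namespace AlmostContactMetric

variable {E : Type*} [NormedAddCommGroup E] [NormedSpace ℝ E] [FiniteDimensional ℝ E]
  {M : Type*} [TopologicalSpace M] [ChartedSpace E M] [IsManifold 𝓘(ℝ, E) ∞ M]
  {s : AlmostContactMetric E M}
  {D : CovariantDerivative 𝓘(ℝ, E) E (fun x : M ↦ TangentSpace 𝓘(ℝ, E) x)}
  {X Y Z : Π x : M, TangentSpace 𝓘(ℝ, E) x}

variable (s D X Y) in
/-- `(∇_X (∇^g ξ))Y` for the connection `∇ = D`. -/
def derivNablaXi (x : M) : TangentSpace 𝓘(ℝ, E) x :=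
  D (fun y ↦ s.nablaXi y (Y y)) x (X x) - s.nablaXi x (D Y x (X x))

namespace IsCharacteristic

variable (hD : s.IsCharacteristic D)

include hD

theorem isSmoothField (hX : IsSmoothField X) (hY : IsSmoothField Y) :
    IsSmoothField (fun y ↦ D Y y (X y)) := by
  have h := hD.smooth.contMDiff.contMDiff (σ := Y)
    (ContMDiff.contMDiffOn (ContMDiff.of_le hY (by simp)))
  exact IsSmoothField.clm_apply (contMDiffOn_univ.1 h) hX

/-- Smoothness is inherited from `D`, because `∇^g_X Y = (D_X Y + D_Y X + [X, Y])/2`. -/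
theorem preservesSmooth : PreservesSmooth s.g := by
  intro X Y hX hY
  have e : (fun y ↦ leviCivita s.g Y y (X y)) = (1 / 2 : ℝ) • ((fun y ↦ D Y y (X y))
      + (fun y ↦ D X y (Y y)) + mlieBracket 𝓘(ℝ, E) X Y) := by
    ext y
    rw [hD.leviCivita_eq (hY.mdiffAt y), D.torsion_apply (hX.mdiffAt y) (hY.mdiffAt y)]
    simp only [Pi.smul_apply, Pi.add_apply]
    module
  rw [e]
  exact (((hD.isSmoothField hX hY).add (hD.isSmoothField hY hX)).add (hX.mlieBracket hY)).const_smul _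

theorem isSmoothField_nablaXi (hY : IsSmoothField Y) :
    IsSmoothField (fun y ↦ s.nablaXi y (Y y)) :=
  hD.preservesSmooth hY s.ξ_smooth

theorem inner_derivNablaXi (hY : IsSmoothField Y) (hZ : IsSmoothField Z) (x : M) :
    s.g.inner x (s.derivNablaXi D X Y x) (Z x) =
      -s.g.inner x (s.derivNablaXi D X Z x) (Y x) := by
  have hAY := (hD.isSmoothField_nablaXi hY).mdiffAt x
  have hAZ := (hD.isSmoothField_nablaXi hZ).mdiffAt x
  have h1 := hD.metric hAY (hZ.mdiffAt x) (X x)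
  have h2 := hD.metric (hY.mdiffAt x) hAZ (X x)
  have e : (fun y ↦ s.g.inner y (s.nablaXi y (Y y)) (Z y)) =
      -fun y ↦ s.g.inner y (Y y) (s.nablaXi y (Z y)) := by
    ext y
    exact hD.inner_nablaXi y (Y y) (Z y)
  rw [e, mvfderiv_neg, neg_apply, h2] at h1
  have h3 := hD.inner_nablaXi x (D Y x (X x)) (Z x)
  have h4 := hD.inner_nablaXi x (Y x) (D Z x (X x))
  rw [s.g.symm x (s.derivNablaXi D X Z x)]
  simp only [derivNablaXi, map_sub, sub_apply]
  linear_combination -h1 - h3 - h4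

theorem riemannCurvature_ξ (hs : s.IsHParallel) (hX : IsSmoothField X) (hY : IsSmoothField Y)
    (x : M) :
    riemannCurvature s.g X Y s.ξ x = s.η x (Y x) • s.tilde x (X x) - s.η x (X x) • s.tilde x (Y x)
      + (s.derivNablaXi D X Y x - s.derivNablaXi D Y X x) := by
  have hb : mlieBracket 𝓘(ℝ, E) X Y x = D Y x (X x) - D X x (Y x) - D.torsion x (X x) (Y x) := by
    rw [D.torsion_apply (hX.mdiffAt x) (hY.mdiffAt x)]; abel
  -- This makes the `ξ`-components of `T(X, AY)` and `T(Y, AX)` cancel, where `A = ∇^g ξ`.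
  have hsymm : s.g.inner x (s.nablaXi x (Y x)) (s.nablaXi x (X x)) =
      s.g.inner x (s.nablaXi x (X x)) (s.nablaXi x (Y x)) := s.g.symm x _ _
  rw [riemannCurvature, hD.leviCivita_eq ((hD.isSmoothField_nablaXi hY).mdiffAt x),
    hD.leviCivita_eq ((hD.isSmoothField_nablaXi hX).mdiffAt x), hb]
  simp only [hD.torsion_eq hs, map_sub, map_add, map_smul, hD.tilde_apply, hD.η_nablaXi,
    hD.nablaXi_ξ, hsymm, derivNablaXi]
  module

theorem inner_tilde (x : M) (u v : TangentSpace 𝓘(ℝ, E) x) :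
    s.g.inner x (s.tilde x u) v = s.g.inner x (s.tilde x v) u := by
  rw [hD.tilde_apply, hD.tilde_apply, map_neg, map_neg, neg_apply, neg_apply, hD.inner_nablaXi,
    hD.inner_nablaXi x _ u, s.g.symm x (s.nablaXi x v)]

/-- A trilinear form symmetric in its first two arguments and skew in its last two vanishes:
alternating the two symmetries three times each returns the form with the opposite sign. -/
theorem derivNablaXi_eq_zero_of_symm [T2Space M]
    (h : ∀ X Y : Π x : M, TangentSpace 𝓘(ℝ, E) x, IsSmoothField X → IsSmoothField Y → ∀ x,
      s.derivNablaXi D X Y x = s.derivNablaXi D Y X x)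
    (hX : IsSmoothField X) (hY : IsSmoothField Y) (x : M) : s.derivNablaXi D X Y x = 0 := by
  apply s.ext_inner_right
  intro w
  obtain ⟨W, hW, rfl⟩ := IsSmoothField.exists_extension w
  have a1 := hD.inner_derivNablaXi (X := X) hY hW x
  have a2 := hD.inner_derivNablaXi (X := W) hX hY x
  have a3 := hD.inner_derivNablaXi (X := Y) hW hX x
  rw [h X W hX hW] at a1
  rw [h W Y hW hY] at a2
  rw [h Y X hY hX] at a3
  simp only [map_zero, zero_apply]
  linarith

theorem hasParallelTorsion_iff (hs : s.IsHParallel) :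
    HasParallelTorsion D ↔ ∀ X Y : Π x : M, TangentSpace 𝓘(ℝ, E) x,
      IsSmoothField X → IsSmoothField Y → ∀ x, s.derivNablaXi D X Y x = 0 := by
  constructor
  · intro h X Y hX hY x
    -- Contracting with the parallel field `ξ` recovers `∇^g ξ`, since `T(ξ, Y) = 2∇^g_Y ξ`.
    have h1 := h X s.ξ Y hX s.ξ_smooth hY x
    have e : (fun y ↦ D.torsion y (s.ξ y) (Y y)) = (2 : ℝ) • fun y ↦ s.nablaXi y (Y y) := by
      ext y
      rw [Pi.smul_apply, hD.nablaXi_apply]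
      module
    have e' : D.torsion x (s.ξ x) (D Y x (X x)) = (2 : ℝ) • s.nablaXi x (D Y x (X x)) := by
      rw [hD.nablaXi_apply]
      module
    rw [e, e', D.isCovariantDerivativeOn.smul_const (2 : ℝ)
      ((hD.isSmoothField_nablaXi hY).mdiffAt x), hD.nabla_ξ] at h1
    simp only [map_zero, zero_apply, smul_apply, sub_zero] at h1
    rw [derivNablaXi]
    linear_combination (norm := module) (1 / 2 : ℝ) • h1
  · intro h X Y Z hX hY hZ x
    have hAY := (hD.isSmoothField_nablaXi hY).mdiffAt x
    have hAZ := (hD.isSmoothField_nablaXi hZ).mdiffAt x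
    have hY' := hY.mdiffAt x
    have hZ' := hZ.mdiffAt x
    have hξ := s.ξ_mdiffAt x
    have fY := s.η_mdifferentiableAt hY'
    have fZ := s.η_mdifferentiableAt hZ'
    have fg := s.g.mdifferentiableAt hAY hZ'
    -- The difference is written with the constant factor `-1`, so that additivity and the Leibniz
    -- rule of `D` apply term by term.
    have e : (fun y ↦ D.torsion y (Y y) (Z y)) =
        (2 : ℝ) • ((((fun y ↦ s.η y (Y y)) • (fun y ↦ s.nablaXi y (Z y)))
          + ((-1 : ℝ) • ((fun y ↦ s.η y (Z y)) • (fun y ↦ s.nablaXi y (Y y)))))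
          + (fun y ↦ s.g.inner y (s.nablaXi y (Y y)) (Z y)) • s.ξ) := by
      ext y
      rw [hD.torsion_eq hs]
      simp only [Pi.smul_apply, Pi.add_apply, Pi.smul_apply']
      module
    have d1 := fY.smul_section hAZ
    have d2 := fZ.smul_section hAY
    have d3 := fg.smul_section hξ
    have d4 := MDifferentiableAt.smul_const_section (a := (-1 : ℝ)) d2
    have d5 := mdifferentiableAt_add_section d1 d4
    have hDc := D.isCovariantDerivativeOn (s := Set.univ)
    rw [e, hDc.smul_const (2 : ℝ) (mdifferentiableAt_add_section d5 d3), hDc.add d5 d3,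
      hDc.add d1 d4, hDc.smul_const (-1 : ℝ) d2, hDc.leibniz hAZ fY, hDc.leibniz hAY fZ,
      hDc.leibniz hξ fg]
    have n1 := sub_eq_zero.1 (hD.nabla_η hY' (X x))
    have n2 := sub_eq_zero.1 (hD.nabla_η hZ' (X x))
    have n3 := hD.metric hAY hZ' (X x)
    have p1 := sub_eq_zero.1 (h X Y hX hY x)
    have p2 := sub_eq_zero.1 (h X Z hX hZ x)
    simp only [smul_apply, add_apply, ContinuousLinearMap.smulRight_apply, n1, n2, n3, p1, p2,
      hD.nabla_ξ, hD.torsion_eq hs]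
    module

end IsCharacteristic

end AlmostContactMetric

/-! ### Equivalence of the curvature conditions; the special classes -/

namespace AlmostContactMetric

variable {E : Type*} [NormedAddCommGroup E] [NormedSpace ℝ E] [FiniteDimensional ℝ E]
  {M : Type*} [TopologicalSpace M] [ChartedSpace E M] [IsManifold 𝓘(ℝ, E) ∞ M]
  {s : AlmostContactMetric E M}
  {D : CovariantDerivative 𝓘(ℝ, E) E (fun x : M ↦ TangentSpace 𝓘(ℝ, E) x)}

namespace IsCharacteristic

variable (hD : s.IsCharacteristic D)

include hD

theorem riemannCurvature_ξ_iff_symm (hs : s.IsHParallel) {X Y : Π x : M, TangentSpace 𝓘(ℝ, E) x}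
    (hX : IsSmoothField X) (hY : IsSmoothField Y) (x : M) :
    riemannCurvature s.g X Y s.ξ x = s.η x (Y x) • s.tilde x (X x) - s.η x (X x) • s.tilde x (Y x) ↔
      s.derivNablaXi D X Y x = s.derivNablaXi D Y X x := by
  rw [hD.riemannCurvature_ξ hs hX hY, add_eq_left, sub_eq_zero]

theorem riemannCurvature_ξ_left_iff [T2Space M] :
    (∀ X Y : Π x : M, TangentSpace 𝓘(ℝ, E) x, IsSmoothField X → IsSmoothField Y → ∀ x,
      riemannCurvature s.g s.ξ X Y x =
        -s.η x (Y x) • s.tilde x (X x) + s.g.inner x (s.tilde x (X x)) (Y x) • s.ξ x) ↔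
    ∀ X Y : Π x : M, TangentSpace 𝓘(ℝ, E) x, IsSmoothField X → IsSmoothField Y → ∀ x,
      riemannCurvature s.g X Y s.ξ x =
        s.η x (Y x) • s.tilde x (X x) - s.η x (X x) • s.tilde x (Y x) := by
  have pair (X Y Z : Π x : M, TangentSpace 𝓘(ℝ, E) x) (hX : IsSmoothField X)
      (hY : IsSmoothField Y) (hZ : IsSmoothField Z) (x : M) :
      s.g.inner x (riemannCurvature s.g s.ξ X Y x) (Z x) =
        s.g.inner x (riemannCurvature s.g Y Z s.ξ x) (X x) :=
    inner_riemannCurvature_pair_symm hD.preservesSmooth s.ξ_smooth hX hY hZ s.ξ_smooth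
      (s.ξ_ne_zero x)
  -- With `X̃` self-adjoint, the right side of (ii) for `(X, Y)` tested against `W` is that of (iii)
  -- for `(Y, W)` tested against `X`, matching the pair symmetry.
  have rhs (x : M) (u v w : TangentSpace 𝓘(ℝ, E) x) :
      s.g.inner x (-s.η x v • s.tilde x u + s.g.inner x (s.tilde x u) v • s.ξ x) w =
        s.g.inner x (s.η x w • s.tilde x v - s.η x v • s.tilde x w) u := by
    simp only [map_add, map_sub, map_smul, add_apply, sub_apply, smul_apply, smul_eq_mul,
      s.inner_ξ, hD.inner_tilde x v u, hD.inner_tilde x w u]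
    ring
  constructor
  · intro h X Y hX hY x
    apply s.ext_inner_right
    intro w
    obtain ⟨W, hW, rfl⟩ := IsSmoothField.exists_extension w
    rw [← pair W X Y hW hX hY, h W X hW hX, rhs]
  · intro h X Y hX hY x
    apply s.ext_inner_right
    intro w
    obtain ⟨W, hW, rfl⟩ := IsSmoothField.exists_extension w
    rw [pair X Y W hX hY hW, h Y W hY hW, rhs]

theorem formS_eq {x : M} {α : Trilinear (TangentSpace 𝓘(ℝ, E) x)}
    (hα : ∀ u v w, α u v w = s.nablaPhi x v w u) (u v : TangentSpace 𝓘(ℝ, E) x) :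
    (s.atPoint x).formS α u v = s.g.inner x (s.S x u) v := by
  have e : (s.atPoint x).formS α u v = s.nablaPhi x (s.ξ x) v u := hα _ _ _
  have h1 : s.S x u = s.φ x (s.nablaXi x u) := rfl
  rw [e, hD.nablaPhi_apply, s.φ_ξ, D.torsion_antisymm, h1, s.inner_φ_left, hD.nablaXi_apply]
  simp

theorem formP_eq {x : M} {α : Trilinear (TangentSpace 𝓘(ℝ, E) x)}
    (hα : ∀ u v w, α u v w = s.nablaPhi x v w u) (u v : TangentSpace 𝓘(ℝ, E) x) :
    (s.atPoint x).formP α u v = -s.g.inner x (s.h x u) v := by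
  have e : (s.atPoint x).formP α u v = s.nablaPhi x u v (s.ξ x) := hα _ _ _
  have h1 (w : TangentSpace 𝓘(ℝ, E) x) :
      D.torsion x (s.ξ x) w = (2 : ℝ) • s.nablaXi x w := by
    rw [hD.nablaXi_apply]
    module
  rw [e, hD.nablaPhi_apply, h1, h1, hD.h_apply]
  simp only [map_sub, map_smul, sub_apply, smul_apply, smul_eq_mul, s.inner_φ_left,
    hD.inner_nablaXi x v]
  rw [s.g.symm x v]
  ring

/-- The terms in `S` contribute `φA - Aφ = h` with `A = ∇^g ξ`, and so does `-P = h`; the factor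
`1/2` averages the two. -/
theorem formH_eq {x : M} {α : Trilinear (TangentSpace 𝓘(ℝ, E) x)}
    (hα : ∀ u v w, α u v w = s.nablaPhi x v w u) (u v : TangentSpace 𝓘(ℝ, E) x) :
    (s.atPoint x).formH α u v = s.g.inner x (s.h x u) v := by
  have h1 (w : TangentSpace 𝓘(ℝ, E) x) : s.S x w = s.φ x (s.nablaXi x w) := rfl
  have h2 : (s.atPoint x).formS α ((s.atPoint x).φ u) ((s.atPoint x).φ v) =
      s.g.inner x (s.S x (s.φ x u)) (s.φ x v) := hD.formS_eq hα _ _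
  rw [LinearACM.formH, h2, hD.formS_eq hα, hD.formP_eq hα, h1, h1, s.g_φ, hD.η_nablaXi,
    hD.h_apply]
  simp only [map_sub, sub_apply]
  ring

theorem tilde_of_isOfClass_classC6C7 {n : ℕ} (hE : Module.finrank ℝ E = 2 * n + 1)
    (hc : s.IsOfClass (fun A ↦ A.classC6C7 n)) (x : M) (v : TangentSpace 𝓘(ℝ, E) x) :
    s.tilde x v = s.S x (s.S x v) := by
  obtain ⟨α, hα, h⟩ := hc x
  have h0 (u : TangentSpace 𝓘(ℝ, E) x) : s.h x u = 0 := by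
    apply s.ext_inner_right
    intro w
    rw [← hD.formH_eq h, (s.atPoint x).formH_of_mem_classC6C7 hE hα]
    simp
  rw [tilde, h0, sub_zero]

theorem tilde_of_isOfClass_classCmin (hc : s.IsOfClass (fun A ↦ A.classCmin)) (x : M)
    (v : TangentSpace 𝓘(ℝ, E) x) : s.tilde x v = -s.S x (s.S x v) := by
  obtain ⟨α, hα, h⟩ := hc x
  have h0 (u : TangentSpace 𝓘(ℝ, E) x) : s.h x u = (2 : ℝ) • s.S x u := by
    apply s.ext_inner_right
    intro w
    rw [← hD.formH_eq h, hα.2, hD.formS_eq h]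
    simp
  rw [tilde, h0]
  module

end IsCharacteristic

end AlmostContactMetric

end

theorem theorem4p7 {n : ℕ} {E : Type*} [NormedAddCommGroup E] [NormedSpace ℝ E]
    [FiniteDimensional ℝ E] (hE : Module.finrank ℝ E = 2 * n + 1)
    {M : Type*} [TopologicalSpace M] [T2Space M] [ChartedSpace E M] [IsManifold 𝓘(ℝ, E) ∞ M]
    (s : AlmostContactMetric E M) (hs : s.IsHParallel)
    (D : CovariantDerivative 𝓘(ℝ, E) E (fun x : M ↦ TangentSpace 𝓘(ℝ, E) x))
    (hD : s.IsCharacteristic D) :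
    List.TFAE [
      HasParallelTorsion D,
      ∀ X Y : Π x : M, TangentSpace 𝓘(ℝ, E) x, IsSmoothField X → IsSmoothField Y → ∀ x,
        riemannCurvature s.g s.ξ X Y x =
          -s.η x (Y x) • s.tilde x (X x) + s.g.inner x (s.tilde x (X x)) (Y x) • s.ξ x,
      ∀ X Y : Π x : M, TangentSpace 𝓘(ℝ, E) x, IsSmoothField X → IsSmoothField Y → ∀ x,
        riemannCurvature s.g X Y s.ξ x =
          s.η x (Y x) • s.tilde x (X x) - s.η x (X x) • s.tilde x (Y x)] ∧
    (s.IsOfClass (fun A ↦ A.classC6C7 n) → ∀ x v, s.tilde x v = s.S x (s.S x v)) ∧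
    (s.IsOfClass (fun A ↦ A.classCmin) → ∀ x v, s.tilde x v = -s.S x (s.S x v)) := by
  have h13 : HasParallelTorsion D ↔
      ∀ X Y : Π x : M, TangentSpace 𝓘(ℝ, E) x, IsSmoothField X → IsSmoothField Y → ∀ x,
        riemannCurvature s.g X Y s.ξ x =
          s.η x (Y x) • s.tilde x (X x) - s.η x (X x) • s.tilde x (Y x) := by
    rw [hD.hasParallelTorsion_iff hs]
    constructor
    · intro h X Y hX hY x
      rw [hD.riemannCurvature_ξ_iff_symm hs hX hY, h X Y hX hY, h Y X hY hX]
    · intro h X Y hX hY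
      exact hD.derivNablaXi_eq_zero_of_symm
        (fun X Y hX hY x ↦ (hD.riemannCurvature_ξ_iff_symm hs hX hY x).1 (h X Y hX hY x)) hX hY
  have h23 := hD.riemannCurvature_ξ_left_iff
  refine ⟨?_, hD.tilde_of_isOfClass_classC6C7 hE, hD.tilde_of_isOfClass_classCmin⟩
  tfae_have 1 ↔ 3 := h13
  tfae_have 2 ↔ 3 := h23
  tfae_finish
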